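/- **Setting.** Let $W:\mathbb R\to\mathbb R$ be strictly increasing and càdlàg, with $W(x+1)-W(x)=W(1)-W(0)$ for all $x$ and $W(0)=0$. Let $dW$ be the induced Lebesgue–Stieltjes measure on $\mathbb T=\mathbb R/\mathbb Z\cong(0,1]$ (so $dW((a,b])=W(b)-W(a)$; atoms are allowed), and let $L^2_{W,0}=\{F\in L^2(dW):\int_{(0,1]}F\,dW=0\}$. Put $$\varrho_{W,0}(s,t)=W(s\wedge t)-\frac{W(s)W(t)}{W(1)},\qquad s,t\in[0,1].$$ A *$W$-Brownian bridge* is a centered Gaussian process $(B_{W,0}(t))_{t\in[0,1]}$, on any probability space, with covariance function $\varrho_{W,0}$. Let $H_{W,\mathcal D}([0,1])$ be the space of càdlàg functions $f:[0,1]\to\mathbb R$ with $f(0)=f(1)=0$ such that $f(x)=\int_{(0,x]}F\,dW$ for all $x\in[0,1]$ and some $F\in L^2_{W,0}$; such an $F$ is unique $dW$-a.e. and is denoted $D_W^-f$. Its inner product is $\langle f,g\rangle_{W,\mathcal D}=\int D_W^-f\,D_W^-g\,dW$. The *Cameron–Martin space* of a square integrable process $(X_t)$ is the space of functions $t\mapsto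 E[\xi X_t]$, $\xi$ in the closed linear span of $\{X_t\}$ in $L^2(P)$, with the inner product that makes $\xi\mapsto E[\xi X_{\cdot}]$ an isometry. For a strictly increasing càglàd $V:\mathbb R\to\mathbb R$ with $V(x+1)-V(x)=V(1)-V(0)$, let $dV$ be the induced measure on $\mathbb T\cong[0,1)$ (so $dV([a,b))=V(b)-V(a)$) and $L^2_V(\mathbb T)=L^2(dV)$. For functions on $\mathbb T$ (1-periodic functions on $\mathbb R$) put $$D_W^-f(x)=\lim_{y\uparrow x}\frac{f(y)-f(x)}{W(y)-W(x)},\qquad D_V^+g(x)=\lim_{y\downarrow x}\frac{g(y)-g(x)}{V(y)-V(x)},$$ and let $\mathfrak D_{W,V}(\mathbb T)$ be the set of càdlàg $f$ for which $D_W^-f$ exists everywhere and is càglàd, and $D_V^+D_W^-f$ exists everywhere and is càdlàg. $H_{W,V}(\mathbb T)$ is the set of limits in $L^2_V(\mathbb T)$ of sequences in $\mathfrak D_{W,V}(\mathbb T)$ that converge in $L^2_V(\mathbb T)$ and are Cauchy for the energetic norm $\|f\|_{1,2}^2=\int_{\mathbb T}(f-D_V^+D_W^-f)f\,dV$. For $u\in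 L^2_V(\mathbb T)$, $D_W^-u$ is the $F\in L^2_{W,0}$, if there is one, with $u(x)=c+\int_{(0,x]}F\,dW$ for $dV$-a.e. $x\in[0,1)$ and some constant $c$. Finally $H_{W,V,\mathcal D}(\mathbb T)$ is the set of $u\in H_{W,V}(\mathbb T)$ that have a càdlàg representative on $\mathbb T$ vanishing at $0$, with $\langle u,v\rangle_{W,V,\mathcal D}=\int_{\mathbb T}D_W^-u\,D_W^-v\,dW$. **Proposition.** Let $B_{W,0}$ be a $W$-Brownian bridge on $[0,1]$. 1. The Cameron–Martin space of $B_{W,0}$ is $(H_{W,\mathcal D}([0,1]),\langle\cdot,\cdot\rangle_{W,\mathcal D})$: the two spaces consist of the same functions and have the same inner product. 2. $(H_{W,\mathcal D}([0,1]),\langle\cdot,\cdot\rangle_{W,\mathcal D})$ is a reproducing kernel Hilbert space with reproducing kernel $\varrho_{W,0}$. 3. For every $V$ as above, $H_{W,\mathcal D}([0,1])\cong H_{W,V,\mathcal D}(\mathbb T)$: the map that sends $f$ to the class in $L^2_V(\mathbb T)$ of its restriction to $[0,1)$ is a well-defined linear bijection from $H_{W,\mathcal D}([0,1])$ onto $H_{W,V,\mathcal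 D}(\mathbb T)$, $D_W^-u$ exists for every $u\in H_{W,V,\mathcal D}(\mathbb T)$, and the map preserves the inner products. -/

import Mathlib

open MeasureTheory ProbabilityTheory Filter Topology Set
open scoped unitInterval ENNReal

noncomputable section

/-! ### Integrators and their measures -/

/-- Right-continuous with left limits. -/
def IsCadlag {α : Type*} [TopologicalSpace α] [Preorder α] (f : α → ℝ) : Prop :=
  (∀ x, ContinuousWithinAt f (Ici x) x) ∧ ∀ x, ∃ l : ℝ, Tendsto f (𝓝[<] x) (𝓝 l)

/-- Left-continuous with right limits. -/
def IsCaglad {α : Type*} [TopologicalSpace α] [Preorder α] (f : α → ℝ) : Prop :=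
  (∀ x, ContinuousWithinAt f (Iic x) x) ∧ ∀ x, ∃ l : ℝ, Tendsto f (𝓝[>] x) (𝓝 l)

/-- The standing assumptions on `W`: strictly increasing, càdlàg, with periodic increments,
normalized by `W 0 = 0`. -/
structure IsCadlagIntegrator (W : ℝ → ℝ) : Prop where
  strictMono : StrictMono W
  cadlag : IsCadlag W
  periodic : ∀ x, W (x + 1) - W x = W 1 - W 0
  map_zero : W 0 = 0

/-- The standing assumptions on `V`: strictly increasing, càglàd, with periodic increments. -/
structure IsCagladIntegrator (V : ℝ → ℝ) : Prop where
  strictMono : StrictMono V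
  caglad : IsCaglad V
  periodic : ∀ x, V (x + 1) - V x = V 1 - V 0

/-- The Lebesgue–Stieltjes measure of an increasing function; it gives `(a, b]` the mass
`U b - U a` if `U` is right-continuous, and `[a, b)` the mass `U b - U a` if `U` is
left-continuous. -/
def lsMeasure (U : ℝ → ℝ) (hU : StrictMono U) : Measure ℝ :=
  hU.monotone.stieltjesFunction.measure

/-- The measure `dW` on the torus, carried by the fundamental domain `(0, 1]`. -/
def wMeasure (W : ℝ → ℝ) (hW : IsCadlagIntegrator W) : Measure ℝ :=
  (lsMeasure W hW.strictMono).restrict (Ioc 0 1)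

/-- The measure `dV` on the torus, carried by the fundamental domain `[0, 1)`. -/
def vMeasure (V : ℝ → ℝ) (hV : IsCagladIntegrator V) : Measure ℝ :=
  (lsMeasure V hV.strictMono).restrict (Ico 0 1)

instance instFiniteWMeasure (W : ℝ → ℝ) (hW : IsCadlagIntegrator W) :
    IsFiniteMeasure (wMeasure W hW) := by
  refine ⟨?_⟩
  rw [wMeasure, lsMeasure, Measure.restrict_apply_univ, StieltjesFunction.measure_Ioc]
  exact ENNReal.ofReal_lt_top

/-- `F ∈ L²_{W,0}`: square integrable on the torus with respect to `dW`, with mean zero. -/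
def MemL2Zero (W : ℝ → ℝ) (hW : IsCadlagIntegrator W) (F : ℝ → ℝ) : Prop :=
  MemLp F 2 (wMeasure W hW) ∧ ∫ s, F s ∂(wMeasure W hW) = 0

/-- The primitive `x ↦ ∫_{(0, x]} F dW`, for `x ∈ [0, 1]`. -/
def wPrimitive (W : ℝ → ℝ) (hW : IsCadlagIntegrator W) (F : ℝ → ℝ) (x : ℝ) : ℝ :=
  ∫ s in Ioc 0 x, F s ∂(wMeasure W hW)

/-! ### The space `H_{W,𝒟}([0,1])` -/

/-- `F` is the generalized derivative `D_W⁻ f` of `f : [0,1] → ℝ`. -/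
def IsWDeriv (W : ℝ → ℝ) (hW : IsCadlagIntegrator W) (f : I → ℝ) (F : ℝ → ℝ) : Prop :=
  MemL2Zero W hW F ∧ ∀ x : I, f x = wPrimitive W hW F x

theorem MemL2Zero.integrable {W : ℝ → ℝ} {hW : IsCadlagIntegrator W} {F : ℝ → ℝ}
    (h : MemL2Zero W hW F) : Integrable F (wMeasure W hW) :=
  h.1.integrable (by norm_num)

theorem IsWDeriv.add {W : ℝ → ℝ} {hW : IsCadlagIntegrator W} {f g : I → ℝ} {F G : ℝ → ℝ}
    (hf : IsWDeriv W hW f F) (hg : IsWDeriv W hW g G) : IsWDeriv W hW (f + g) (F + G) := by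
  refine ⟨⟨hf.1.1.add hg.1.1, ?_⟩, fun x => ?_⟩
  · simp only [Pi.add_apply]
    rw [integral_add hf.1.integrable hg.1.integrable, hf.1.2, hg.1.2, add_zero]
  · simp only [Pi.add_apply, wPrimitive]
    rw [integral_add hf.1.integrable.integrableOn hg.1.integrable.integrableOn, hf.2, hg.2]
    rfl

theorem IsWDeriv.smul {W : ℝ → ℝ} {hW : IsCadlagIntegrator W} {f : I → ℝ} {F : ℝ → ℝ}
    (c : ℝ) (hf : IsWDeriv W hW f F) : IsWDeriv W hW (c • f) (c • F) := by
  refine ⟨⟨hf.1.1.const_smul c, ?_⟩, fun x => ?_⟩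
  · simp only [Pi.smul_apply, smul_eq_mul]
    rw [integral_const_mul, hf.1.2, mul_zero]
  · simp only [Pi.smul_apply, smul_eq_mul, wPrimitive]
    rw [integral_const_mul, hf.2]
    rfl

/-- The generalized derivative is unique `dW`-almost everywhere. -/
theorem IsWDeriv.ae_eq {W : ℝ → ℝ} {hW : IsCadlagIntegrator W} {f : I → ℝ} {F G : ℝ → ℝ}
    (hF : IsWDeriv W hW f F) (hG : IsWDeriv W hW f G) : F =ᵐ[wMeasure W hW] G := by
  have hFG : Integrable (F - G) (wMeasure W hW) := hF.1.integrable.sub hG.1.integrable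
  have hIoc : ∀ x : I, ∫ s in Ioc 0 (x : ℝ), (F - G) s ∂(wMeasure W hW) = 0 := by
    intro x
    simp only [Pi.sub_apply]
    rw [integral_sub hF.1.integrable.integrableOn hG.1.integrable.integrableOn, sub_eq_zero]
    exact (hF.2 x).symm.trans (hG.2 x)
  have huniv : ∫ s, (F - G) s ∂(wMeasure W hW) = 0 := by
    simp only [Pi.sub_apply]
    rw [integral_sub hF.1.integrable hG.1.integrable, hF.1.2, hG.1.2, sub_zero]
  have hIic : ∀ x : ℝ, ∫ s in Iic x, (F - G) s ∂(wMeasure W hW) = 0 := by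
    intro x
    have hx : Iic x =ᵐ[wMeasure W hW] Ioc 0 ((projIcc 0 1 zero_le_one x : I) : ℝ) := by
      have hmem : ∀ᵐ s ∂(wMeasure W hW), s ∈ Ioc (0 : ℝ) 1 :=
        ae_restrict_mem measurableSet_Ioc
      refine eventuallyEq_set.2 (hmem.mono fun s hs => ?_)
      simp only [mem_Iic, mem_Ioc, coe_projIcc, le_max_iff, le_min_iff]
      exact ⟨fun h => ⟨hs.1, Or.inr ⟨hs.2, h⟩⟩,
        fun h => h.2.elim (fun h0 => absurd hs.1 (not_lt.2 h0)) fun h1 => h1.2⟩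
    rw [setIntegral_congr_set hx]
    exact hIoc _
  have hall : ∀ s : Set ℝ, MeasurableSet s → ∫ x in s, (F - G) x ∂(wMeasure W hW) = 0 := by
    intro s hs
    induction s, hs using MeasurableSpace.induction_on_inter
      ((BorelSpace.measurable_eq (α := ℝ)).trans (borel_eq_generateFrom_Iic ℝ))
      (isPiSystem_Iic (α := ℝ)) with
    | empty => simp
    | basic t ht =>
      obtain ⟨x, rfl⟩ := ht
      exact hIic x
    | compl t ht h => rw [setIntegral_compl ht hFG, huniv, h, sub_zero]
    | iUnion f hd hm h =>
      rw [integral_iUnion hm hd hFG.integrableOn]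
      simp only [h, tsum_zero]
  have h0 : F - G =ᵐ[wMeasure W hW] 0 :=
    hFG.ae_eq_zero_of_forall_setIntegral_eq_zero fun s hs _ => hall s hs
  exact h0.mono fun s hs => sub_eq_zero.1 hs

/-- The càdlàg functions on `[0,1]` that vanish at `0` and `1` and are of the form
`f(x) = ∫_{(0, x]} F dW` with `F ∈ L²_{W,0}`. -/
def dirichletSubmodule (W : ℝ → ℝ) (hW : IsCadlagIntegrator W) : Submodule ℝ (I → ℝ) where
  carrier := {f | IsCadlag f ∧ f 0 = 0 ∧ f 1 = 0 ∧ ∃ F, IsWDeriv W hW f F}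
  zero_mem' := by
    refine ⟨⟨fun x => continuousWithinAt_const, fun x => ⟨0, tendsto_const_nhds⟩⟩, rfl, rfl,
      0, ⟨⟨MemLp.zero, by simp⟩, fun x => by simp [wPrimitive]⟩⟩
  add_mem' := by
    rintro f g ⟨⟨hf, hf'⟩, hf0, hf1, F, hF⟩ ⟨⟨hg, hg'⟩, hg0, hg1, G, hG⟩
    refine ⟨⟨fun x => (hf x).add (hg x), fun x => ?_⟩, by simp [hf0, hg0], by simp [hf1, hg1],
      F + G, hF.add hG⟩
    obtain ⟨l, hl⟩ := hf' x
    obtain ⟨m, hm⟩ := hg' x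
    exact ⟨l + m, hl.add hm⟩
  smul_mem' := by
    rintro c f ⟨⟨hf, hf'⟩, hf0, hf1, F, hF⟩
    refine ⟨⟨fun x => (hf x).const_smul c, fun x => ?_⟩, by simp [hf0], by simp [hf1],
      c • F, hF.smul c⟩
    obtain ⟨l, hl⟩ := hf' x
    exact ⟨c • l, hl.const_smul c⟩

/-- The space `H_{W,𝒟}([0,1])`. -/
def DirichletSpace (W : ℝ → ℝ) (hW : IsCadlagIntegrator W) : Type :=
  dirichletSubmodule W hW

namespace DirichletSpace

variable {W : ℝ → ℝ} {hW : IsCadlagIntegrator W}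

instance instAddCommGroup : AddCommGroup (DirichletSpace W hW) :=
  inferInstanceAs (AddCommGroup (dirichletSubmodule W hW))

instance instModule : Module ℝ (DirichletSpace W hW) :=
  inferInstanceAs (Module ℝ (dirichletSubmodule W hW))

/-- The function on `[0,1]` underlying an element of the space. -/
def toFun (f : DirichletSpace W hW) : I → ℝ := Subtype.val f

/-- The generalized derivative `D_W⁻ f` (a representative; unique `dW`-almost everywhere). -/
def deriv (f : DirichletSpace W hW) : ℝ → ℝ :=
  Classical.choose (Subtype.property f).2.2.2

theorem isWDeriv_deriv (f : DirichletSpace W hW) : IsWDeriv W hW f.toFun f.deriv :=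
  Classical.choose_spec (Subtype.property f).2.2.2

theorem integrable_mul (f g : DirichletSpace W hW) :
    Integrable (fun s => f.deriv s * g.deriv s) (wMeasure W hW) :=
  f.isWDeriv_deriv.1.1.integrable_mul g.isWDeriv_deriv.1.1

/-- The inner product `⟨f, g⟩ = ∫ D_W⁻ f · D_W⁻ g dW`. -/
instance instCore : InnerProductSpace.Core ℝ (DirichletSpace W hW) where
  inner f g := ∫ s, f.deriv s * g.deriv s ∂(wMeasure W hW)
  conj_inner_symm f g := by
    simp only [conj_trivial]
    exact integral_congr_ae (ae_of_all _ fun s => mul_comm _ _)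
  re_inner_nonneg f := by
    simp only [RCLike.re_to_real]
    exact integral_nonneg fun s => mul_self_nonneg _
  add_left f g h := by
    have h1 : (f + g).deriv =ᵐ[wMeasure W hW] f.deriv + g.deriv :=
      (f + g).isWDeriv_deriv.ae_eq (f.isWDeriv_deriv.add g.isWDeriv_deriv)
    rw [← integral_add (integrable_mul f h) (integrable_mul g h)]
    refine integral_congr_ae (h1.mono fun s hs => ?_)
    simp only [hs, Pi.add_apply, add_mul]
  smul_left f g r := by
    have h1 : (r • f).deriv =ᵐ[wMeasure W hW] r • f.deriv :=
      (r • f).isWDeriv_deriv.ae_eq (f.isWDeriv_deriv.smul r)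
    simp only [conj_trivial]
    rw [← integral_const_mul]
    refine integral_congr_ae (h1.mono fun s hs => ?_)
    simp only [hs, Pi.smul_apply, smul_eq_mul, mul_assoc]
  definite f hf := by
    have h1 : (fun s => f.deriv s * f.deriv s) =ᵐ[wMeasure W hW] 0 :=
      (integral_eq_zero_iff_of_nonneg (fun s => mul_self_nonneg _) (integrable_mul f f)).1 hf
    have h2 : f.deriv =ᵐ[wMeasure W hW] 0 := h1.mono fun s hs => mul_self_eq_zero.1 hs
    refine Subtype.ext (funext fun x => ?_)
    refine (f.isWDeriv_deriv.2 x).trans ?_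
    rw [wPrimitive, integral_congr_ae (ae_restrict_of_ae h2)]
    simp
    rfl

instance instNormedAddCommGroup : NormedAddCommGroup (DirichletSpace W hW) :=
  (instCore (W := W) (hW := hW)).toNormedAddCommGroup

instance instInnerProductSpace : InnerProductSpace ℝ (DirichletSpace W hW) :=
  InnerProductSpace.ofCore (instCore (W := W) (hW := hW)).toCore

end DirichletSpace

/-! ### Gaussian processes and Cameron–Martin spaces -/

/-- The kernel `W(s ∧ t) - W(s) W(t) / W(1)`. -/
def bridgeKernel (W : ℝ → ℝ) (s t : I) : ℝ :=
  W (min (s : ℝ) (t : ℝ)) - W s * W t / W 1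

/-- `X` is a `W`-Brownian bridge on `[0,1]`: a centered Gaussian process with covariance function
`bridgeKernel W`. -/
structure IsWBrownianBridge (W : ℝ → ℝ) {Ω : Type*} [MeasurableSpace Ω] (X : I → Ω → ℝ)
    (P : Measure Ω) : Prop where
  gaussian : IsGaussianProcess X P
  centered : ∀ t, ∫ ω, X t ω ∂P = 0
  covariance : ∀ s t, cov[X s, X t; P] = bridgeKernel W s t

theorem IsWBrownianBridge.memLp {W : ℝ → ℝ} {Ω : Type*} [MeasurableSpace Ω] {X : I → Ω → ℝ}
    {P : Measure Ω} (h : IsWBrownianBridge W X P) (t : I) : MemLp (X t) 2 P :=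
  (h.gaussian.hasGaussianLaw_eval t).memLp_two

section CameronMartin

variable {T Ω : Type*} [MeasurableSpace Ω] (X : T → Ω → ℝ) (P : Measure Ω)
  (hX : ∀ t, MemLp (X t) 2 P)

/-- The closed linear span in `L²(P)` of a square integrable process (the Gaussian Hilbert space
of the process if the process is centered Gaussian). -/
def processSpan : Submodule ℝ (Lp ℝ 2 P) :=
  (Submodule.span ℝ (range fun t => (hX t).toLp (X t))).topologicalClosure

/-- The map that sends `ξ` in the closed span to the function `t ↦ E[ξ X_t]`. -/
def cameronMartinMap : processSpan X P hX →ₗ[ℝ] (T → ℝ) where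
  toFun ξ := fun t => inner ℝ (ξ : Lp ℝ 2 P) ((hX t).toLp (X t))
  map_add' ξ η := by
    funext t
    simp [inner_add_left]
  map_smul' c ξ := by
    funext t
    simp [inner_smul_left]

theorem cameronMartinMap_apply (ξ : processSpan X P hX) (t : T) :
    cameronMartinMap X P hX ξ t = ∫ ω, (ξ : Lp ℝ 2 P) ω * X t ω ∂P := by
  change inner ℝ (ξ : Lp ℝ 2 P) ((hX t).toLp (X t)) = _
  rw [L2.inner_def]
  refine integral_congr_ae ((hX t).coeFn_toLp.mono fun ω hω => ?_)
  simp [hω, mul_comm]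

theorem cameronMartinMap_injective : Function.Injective (cameronMartinMap X P hX) := by
  refine (injective_iff_map_eq_zero _).2 fun ξ hξ => ?_
  have h1 : (ξ : Lp ℝ 2 P) ∈ (Submodule.span ℝ (range fun t => (hX t).toLp (X t)))ᗮ := by
    rw [Submodule.mem_orthogonal']
    intro u hu
    induction hu using Submodule.span_induction with
    | mem u hu =>
      obtain ⟨t, rfl⟩ := hu
      exact congrFun hξ t
    | zero => exact inner_zero_right _
    | add u v _ _ hu hv => rw [inner_add_right, hu, hv, add_zero]
    | smul c u _ hu => rw [inner_smul_right, hu, mul_zero]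
  rw [← Submodule.orthogonal_closure] at h1
  have h2 : inner ℝ (ξ : Lp ℝ 2 P) (ξ : Lp ℝ 2 P) = 0 :=
    (Submodule.mem_orthogonal _ _).1 h1 _ ξ.2
  exact Subtype.ext (inner_self_eq_zero.1 h2)

/-- The Cameron–Martin space of a process: the functions `t ↦ E[ξ X_t]`, for `ξ` in the closed
linear span of the process, with the inner product carried over from `L²(P)`. -/
def CameronMartinSpace : Type _ := LinearMap.range (cameronMartinMap X P hX)

namespace CameronMartinSpace

variable {X P hX}

instance instAddCommGroup : AddCommGroup (CameronMartinSpace X P hX) :=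
  inferInstanceAs (AddCommGroup (LinearMap.range (cameronMartinMap X P hX)))

instance instModule : Module ℝ (CameronMartinSpace X P hX) :=
  inferInstanceAs (Module ℝ (LinearMap.range (cameronMartinMap X P hX)))

/-- The function underlying an element of the Cameron–Martin space. -/
def toFun (f : CameronMartinSpace X P hX) : T → ℝ := Subtype.val f

/-- The random variable `ξ` in the closed span that represents `f`, that is, `f t = E[ξ X_t]`. -/
def repr : CameronMartinSpace X P hX ≃ₗ[ℝ] processSpan X P hX :=
  (LinearEquiv.ofInjective (cameronMartinMap X P hX) (cameronMartinMap_injective X P hX)).symm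

/-- The inner product `⟨f, g⟩ = E[ξ η]` where `f t = E[ξ X_t]` and `g t = E[η X_t]`. -/
instance instCore : InnerProductSpace.Core ℝ (CameronMartinSpace X P hX) where
  inner f g := inner ℝ (repr f) (repr g)
  conj_inner_symm f g := by simp only [conj_trivial]; exact real_inner_comm _ _
  re_inner_nonneg f := by simp only [RCLike.re_to_real]; exact real_inner_self_nonneg
  add_left f g h := by rw [map_add, inner_add_left]
  smul_left f g r := by rw [map_smul]; exact inner_smul_left (𝕜 := ℝ) (repr f) (repr g) r
  definite f hf := by
    have h1 : repr f = 0 := inner_self_eq_zero.1 hf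
    exact (map_eq_zero_iff _ repr.injective).1 h1

instance instNormedAddCommGroup : NormedAddCommGroup (CameronMartinSpace X P hX) :=
  (instCore (X := X) (P := P) (hX := hX)).toNormedAddCommGroup

instance instInnerProductSpace : InnerProductSpace ℝ (CameronMartinSpace X P hX) :=
  InnerProductSpace.ofCore (instCore (X := X) (P := P) (hX := hX)).toCore

end CameronMartinSpace

end CameronMartin

/-! ### The Sobolev space `H_{W,V}(𝕋)` and its Dirichlet subspace

Functions on the torus `𝕋 = ℝ / ℤ` are 1-periodic functions on `ℝ`; the tagged point is `0`. -/

/-- `D_W⁻ f (x) = l`. -/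
def HasLeftDeriv (W f : ℝ → ℝ) (x l : ℝ) : Prop :=
  Tendsto (fun y => (f y - f x) / (W y - W x)) (𝓝[<] x) (𝓝 l)

/-- `D_V⁺ g (x) = l`. -/
def HasRightDeriv (V g : ℝ → ℝ) (x l : ℝ) : Prop :=
  Tendsto (fun y => (g y - g x) / (V y - V x)) (𝓝[>] x) (𝓝 l)

/-- `f` lies in the strong domain `𝔇_{W,V}(𝕋)`, with `D_W⁻ f = g` and `D_V⁺ D_W⁻ f = h`. -/
structure IsStrong (W V f g h : ℝ → ℝ) : Prop where
  periodic : Function.Periodic f 1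
  cadlag : IsCadlag f
  left_deriv : ∀ x, HasLeftDeriv W f x (g x)
  caglad_deriv : IsCaglad g
  right_deriv : ∀ x, HasRightDeriv V g x (h x)
  cadlag_deriv : IsCadlag h

/-- The squared energetic norm `⟨(I - D_V⁺ D_W⁻) f, f⟩_V`, where `h = D_V⁺ D_W⁻ f`. -/
def energy (V : ℝ → ℝ) (hV : IsCagladIntegrator V) (f h : ℝ → ℝ) : ℝ :=
  ∫ x, (f x - h x) * f x ∂(vMeasure V hV)

/-- `u ∈ H_{W,V}(𝕋)`, the energetic space of `I - D_V⁺ D_W⁻` on `𝔇_{W,V}(𝕋)`: the class `u` is the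
limit in `L²_V(𝕋)` of a sequence in the strong domain that is Cauchy in the energetic norm. -/
def MemSobolev (W V : ℝ → ℝ) (hV : IsCagladIntegrator V) (u : Lp ℝ 2 (vMeasure V hV)) : Prop :=
  ∃ f g h : ℕ → ℝ → ℝ, (∀ n, IsStrong W V (f n) (g n) (h n)) ∧
    Tendsto (fun n => eLpNorm (fun x => f n x - u x) 2 (vMeasure V hV)) atTop (𝓝 0) ∧
    ∀ ε > 0, ∃ N, ∀ m ≥ N, ∀ n ≥ N, energy V hV (f m - f n) (h m - h n) < ε

/-- `u ∈ H_{W,V,𝒟}(𝕋)`: `u ∈ H_{W,V}(𝕋)` and `u(0) = 0`, where the value at `0` is that of the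
càdlàg function on the torus which represents the class `u`. -/
def MemSobolevDirichlet (W V : ℝ → ℝ) (hV : IsCagladIntegrator V)
    (u : Lp ℝ 2 (vMeasure V hV)) : Prop :=
  MemSobolev W V hV u ∧ ∃ f : ℝ → ℝ, Function.Periodic f 1 ∧ IsCadlag f ∧
    u =ᵐ[vMeasure V hV] f ∧ f 0 = 0

/-- `F = D_W⁻ u` for a class `u ∈ L²_V(𝕋)`: `F ∈ L²_{W,0}` and `u(x) = c + ∫_{(0, x]} F dW` for
`dV`-almost every `x`, for some constant `c`. -/
def IsTorusDeriv (W V : ℝ → ℝ) (hW : IsCadlagIntegrator W) (hV : IsCagladIntegrator V)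
    (u : Lp ℝ 2 (vMeasure V hV)) (F : ℝ → ℝ) : Prop :=
  MemL2Zero W hW F ∧ ∃ c : ℝ, ∀ᵐ x ∂(vMeasure V hV), u x = c + wPrimitive W hW F x

end

/-!
The proof compares everything with the Hilbert space `L²_{W,0}` of mean zero functions.

*Kernel and Cameron–Martin space.* Taking the generalized derivative identifies `H_{W,𝒟}([0,1])`
isometrically with `L²_{W,0}`, a closed subspace of `L²(dW)`, so the space is complete. Since a
derivative `F` has mean zero, `f(t) = ∫_{(0, t]} F dW` is also the pairing of `F` with `1_{(0, t]} -
W(t) / W(1)`, which is the derivative of `ϱ_{W,0}(·, t)`: this is the reproducing property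
(`DirichletSpace.inner_kernelFun`). The kernel functions are therefore total, and their Gram matrix
is the covariance of the bridge. Two total families with the same Gram matrix differ by a unitary
operator (`exists_linearIsometryEquiv_of_inner_eq`), which by the reproducing property is `ξ ↦ E[ξ
X_·]`.

*Sobolev space on the torus.* The link with the strong domain is a fundamental theorem of calculus
for one-sided derivatives (`eq_of_hasLeftDeriv_zero`, `sub_eq_setIntegral_Ioc`,
`sub_eq_setIntegral_Ico`): a càdlàg function with càglàd left `W`-derivative is the `dW`-integral of
that derivative, and symmetrically for `V` by reflection. Together with Fubini's theorem it gives
the integration by parts `∫ F g dW = - ∫ h φ dV` for `h = D_V⁺ g` and `φ` the primitive of a mean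
zero `F` (`MemL2Zero.integral_mul_eq_neg`). It has two consequences.
* The energetic norm is `‖f‖_V² + ‖D_W⁻ f‖_W²` (`IsStrong.energy_eq`). Hence an energetic Cauchy
  sequence, corrected by its values at `0`, converges in `H_{W,𝒟}([0,1])`, and every element of
  `H_{W,V}(𝕋)` is an element of `H_{W,𝒟}([0,1])` plus a constant. A càdlàg function is determined by
  its `dV`-class, because `dV` charges all intervals; so the constant is the value at `0`.
* The strong domain is dense (`strongSubmodule_topologicalClosure`): as `D_V⁺ D_W⁻ f = h` is
  solvable for every càdlàg `h` of mean zero, a `φ` orthogonal to the strong domain is orthogonal in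
  `L²(dV)` to all such `h`, in particular to `φ` minus its mean, so that `φ` is constant and
  vanishes.
-/

noncomputable section

/-! ### Càdlàg and càglàd functions on the line -/

theorem IsCaglad.comp_neg {f : ℝ → ℝ} (hf : IsCaglad f) : IsCadlag fun x => f (-x) := by
  refine ⟨fun x => ?_, fun x => ?_⟩
  · refine (hf.1 (-x)).comp continuous_neg.continuousWithinAt fun y hy => ?_
    simpa using hy
  · obtain ⟨l, hl⟩ := hf.2 (-x)
    exact ⟨l, hl.comp tendsto_neg_nhdsLT⟩

theorem IsCadlag.comp_neg {f : ℝ → ℝ} (hf : IsCadlag f) : IsCaglad fun x => f (-x) := by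
  refine ⟨fun x => ?_, fun x => ?_⟩
  · refine (hf.1 (-x)).comp continuous_neg.continuousWithinAt fun y hy => ?_
    simpa using hy
  · obtain ⟨l, hl⟩ := hf.2 (-x)
    exact ⟨l, hl.comp tendsto_neg_nhdsGT⟩

theorem IsCadlag.sub {f g : ℝ → ℝ} (hf : IsCadlag f) (hg : IsCadlag g) : IsCadlag (f - g) := by
  refine ⟨fun x => (hf.1 x).sub (hg.1 x), fun x => ?_⟩
  obtain ⟨l, hl⟩ := hf.2 x
  obtain ⟨m, hm⟩ := hg.2 x
  exact ⟨l - m, hl.sub hm⟩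

theorem IsCadlag.neg {f : ℝ → ℝ} (hf : IsCadlag f) : IsCadlag fun x => -f x := by
  refine ⟨fun x => (hf.1 x).neg, fun x => ?_⟩
  obtain ⟨l, hl⟩ := hf.2 x
  exact ⟨-l, hl.neg⟩

theorem IsCaglad.sub {f g : ℝ → ℝ} (hf : IsCaglad f) (hg : IsCaglad g) : IsCaglad (f - g) := by
  refine ⟨fun x => (hf.1 x).sub (hg.1 x), fun x => ?_⟩
  obtain ⟨l, hl⟩ := hf.2 x
  obtain ⟨m, hm⟩ := hg.2 x
  exact ⟨l - m, hl.sub hm⟩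

theorem IsCadlag.const_smul {f : ℝ → ℝ} (hf : IsCadlag f) (c : ℝ) : IsCadlag (c • f) := by
  refine ⟨fun x => (hf.1 x).const_smul c, fun x => ?_⟩
  obtain ⟨l, hl⟩ := hf.2 x
  exact ⟨c • l, hl.const_smul c⟩

theorem IsCaglad.const_smul {f : ℝ → ℝ} (hf : IsCaglad f) (c : ℝ) : IsCaglad (c • f) := by
  refine ⟨fun x => (hf.1 x).const_smul c, fun x => ?_⟩
  obtain ⟨l, hl⟩ := hf.2 x
  exact ⟨c • l, hl.const_smul c⟩

theorem isCadlag_const (c : ℝ) : IsCadlag fun _ : ℝ => c :=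
  ⟨fun _ => continuousWithinAt_const, fun _ => ⟨c, tendsto_const_nhds⟩⟩

theorem isCaglad_const (c : ℝ) : IsCaglad fun _ : ℝ => c :=
  ⟨fun _ => continuousWithinAt_const, fun _ => ⟨c, tendsto_const_nhds⟩⟩

theorem IsCadlag.comp_sub {f : ℝ → ℝ} (hf : IsCadlag f) (p : ℝ) :
    IsCadlag fun x => f (x - p) := by
  have hc : Continuous fun x : ℝ => x - p := by fun_prop
  refine ⟨fun x => ContinuousWithinAt.comp (f := fun x : ℝ => x - p) (hf.1 (x - p))
    hc.continuousWithinAt fun y hy => sub_le_sub_right (mem_Ici.1 hy) p, fun x => ?_⟩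
  obtain ⟨l, hl⟩ := hf.2 (x - p)
  refine ⟨l, hl.comp (tendsto_nhdsWithin_iff.2
    ⟨(hc.tendsto x).mono_left nhdsWithin_le_nhds, ?_⟩)⟩
  filter_upwards [self_mem_nhdsWithin] with y (hy : y < x)
  exact sub_lt_sub_right hy p

/-- A right-continuous function is the limit of the step functions
`x ↦ f ((⌊n x⌋ + 1) / n)`. -/
theorem IsCadlag.measurable {f : ℝ → ℝ} (hf : IsCadlag f) : Measurable f := by
  let a : ℕ → ℝ → ℝ := fun n x => ((⌊((n : ℝ) + 1) * x⌋ : ℝ) + 1) / ((n : ℝ) + 1)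
  have ha : ∀ n x, x ≤ a n x ∧ a n x ≤ x + 1 / ((n : ℝ) + 1) := by
    intro n x
    have hn : (0 : ℝ) < (n : ℝ) + 1 := by positivity
    have h1 := Int.lt_floor_add_one (((n : ℝ) + 1) * x)
    have h2 := Int.floor_le (((n : ℝ) + 1) * x)
    refine ⟨?_, ?_⟩
    · rw [le_div_iff₀ hn]; linarith
    · rw [div_le_iff₀ hn, add_mul x, one_div_mul_cancel hn.ne']; linarith
  refine measurable_of_tendsto_metrizable (f := fun n x => f (a n x)) (fun n => ?_) ?_
  · exact (measurable_from_top (f := fun k : ℤ => f (((k : ℝ) + 1) / ((n : ℝ) + 1)))).comp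
      (Int.measurable_floor.comp (measurable_const_mul _))
  · refine tendsto_pi_nhds.2 fun x => (hf.1 x).tendsto.comp ?_
    refine tendsto_nhdsWithin_iff.2 ⟨?_, Eventually.of_forall fun n => (ha n x).1⟩
    refine tendsto_of_tendsto_of_tendsto_of_le_of_le tendsto_const_nhds ?_
      (fun n => (ha n x).1) (fun n => (ha n x).2)
    simpa using tendsto_const_nhds.add (tendsto_one_div_add_atTop_nhds_zero_nat (𝕜 := ℝ))

theorem IsCaglad.measurable {f : ℝ → ℝ} (hf : IsCaglad f) : Measurable f := by
  simpa [Function.comp_def] using hf.comp_neg.measurable.comp measurable_neg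

theorem exists_forall_Icc_abs_le {f : ℝ → ℝ} (a b : ℝ)
    (hf : ∀ x, ∃ C, ∀ᶠ y in 𝓝 x, |f y| ≤ C) : ∃ C, ∀ x ∈ Icc a b, |f x| ≤ C := by
  refine isCompact_Icc.induction_on (p := fun s => ∃ C, ∀ x ∈ s, |f x| ≤ C) ⟨0, by simp⟩ ?_ ?_ ?_
  · rintro s t hst ⟨C, hC⟩
    exact ⟨C, fun x hx => hC x (hst hx)⟩
  · rintro s t ⟨C, hC⟩ ⟨D, hD⟩
    refine ⟨max C D, fun x hx => hx.elim (fun h => (hC x h).trans (le_max_left _ _))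
      fun h => (hD x h).trans (le_max_right _ _)⟩
  · intro x _
    obtain ⟨C, hC⟩ := hf x
    exact ⟨_, mem_nhdsWithin_of_mem_nhds hC, C, fun y hy => hy⟩

theorem IsCadlag.bounded {f : ℝ → ℝ} (hf : IsCadlag f) (a b : ℝ) :
    ∃ C, ∀ x ∈ Icc a b, |f x| ≤ C := by
  refine exists_forall_Icc_abs_le a b fun x => ?_
  obtain ⟨l, hl⟩ := hf.2 x
  refine ⟨max (|l| + 1) (|f x| + 1), ?_⟩
  rw [← nhdsLT_sup_nhdsGE, eventually_sup]
  constructor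
  · filter_upwards [hl.abs.eventually_lt_const (lt_add_one _)] with y hy
    exact hy.le.trans (le_max_left _ _)
  · filter_upwards [(hf.1 x).tendsto.abs.eventually_lt_const (lt_add_one _)] with y hy
    exact hy.le.trans (le_max_right _ _)

theorem IsCaglad.bounded {f : ℝ → ℝ} (hf : IsCaglad f) (a b : ℝ) :
    ∃ C, ∀ x ∈ Icc a b, |f x| ≤ C := by
  obtain ⟨C, hC⟩ := hf.comp_neg.bounded (-b) (-a)
  refine ⟨C, fun x hx => ?_⟩
  simpa using hC (-x) ⟨neg_le_neg hx.2, neg_le_neg hx.1⟩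

theorem IsCaglad.integrableOn {f : ℝ → ℝ} (hf : IsCaglad f) (ν : Measure ℝ)
    [IsLocallyFiniteMeasure ν] (a b : ℝ) : IntegrableOn f (Icc a b) ν := by
  obtain ⟨C, hC⟩ := hf.bounded a b
  exact Measure.integrableOn_of_bounded measure_Icc_lt_top.ne hf.measurable.aestronglyMeasurable
    ((ae_restrict_mem measurableSet_Icc).mono fun x hx => hC x hx)

/-- Being càdlàg is a local property. -/
theorem IsCadlag.of_eventuallyEq {f : ℝ → ℝ}
    (h : ∀ x, ∃ g, IsCadlag g ∧ f =ᶠ[𝓝 x] g) : IsCadlag f := by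
  refine ⟨fun x => ?_, fun x => ?_⟩
  · obtain ⟨g, hg, hfg⟩ := h x
    exact (hg.1 x).congr_of_eventuallyEq (hfg.filter_mono nhdsWithin_le_nhds) hfg.self_of_nhds
  · obtain ⟨g, hg, hfg⟩ := h x
    obtain ⟨l, hl⟩ := hg.2 x
    exact ⟨l, hl.congr' (hfg.symm.filter_mono nhdsWithin_le_nhds)⟩

/-- The distribution function of a finite signed measure is càdlàg. -/
theorem isCadlag_integral_Iic {ν : Measure ℝ} {F : ℝ → ℝ} (hF : Integrable F ν) :
    IsCadlag fun x => ∫ s in Iic x, F s ∂ν := by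
  have key : ∀ (l : Filter ℝ) [l.IsCountablyGenerated] (t : Set ℝ), MeasurableSet t →
      (∀ s, ∀ᶠ y in l, (s ∈ Iic y ↔ s ∈ t)) →
      Tendsto (fun x => ∫ s in Iic x, F s ∂ν) l (𝓝 (∫ s in t, F s ∂ν)) := by
    intro l _ t ht h
    simp_rw [← integral_indicator ht, ← integral_indicator (measurableSet_Iic (α := ℝ))]
    refine tendsto_integral_filter_of_dominated_convergence (fun s => ‖F s‖)
      (Eventually.of_forall fun y => (hF.indicator measurableSet_Iic).aestronglyMeasurable)
      (Eventually.of_forall fun y => ae_of_all _ fun s => norm_indicator_le_norm_self _ _)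
      hF.norm (ae_of_all _ fun s => ?_)
    refine tendsto_const_nhds.congr' ?_
    filter_upwards [h s] with y hy
    by_cases hs : s ∈ t
    · rw [indicator_of_mem hs, indicator_of_mem (hy.2 hs)]
    · rw [indicator_of_notMem hs, indicator_of_notMem (fun h => hs (hy.1 h))]
  refine ⟨fun x => key _ (Iic x) measurableSet_Iic fun s => ?_,
    fun x => ⟨_, key _ (Iio x) measurableSet_Iio fun s => ?_⟩⟩
  · rcases le_or_gt s x with hs | hs
    · filter_upwards [self_mem_nhdsWithin] with y (hy : x ≤ y)
      simp [hs, hs.trans hy]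
    · filter_upwards [mem_nhdsWithin_of_mem_nhds (Iio_mem_nhds hs)] with y (hy : y < s)
      simp [not_le.2 hs, not_le.2 hy]
  · rcases lt_or_ge s x with hs | hs
    · filter_upwards [mem_nhdsWithin_of_mem_nhds (Ioi_mem_nhds hs)] with y (hy : s < y)
      simp [hs, hy.le]
    · filter_upwards [self_mem_nhdsWithin] with y (hy : y < x)
      simp [not_lt.2 hs, not_le.2 (hy.trans_le hs)]

/-- The periodic extension of the restriction to `[0, 1)` of a càdlàg function is càdlàg. -/
theorem IsCadlag.comp_fract {f : ℝ → ℝ} (hf : IsCadlag f) : IsCadlag fun x => f (Int.fract x) := by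
  have heq : ∀ (n : ℤ) (y : ℝ), (n : ℝ) ≤ y → y < n + 1 → f (Int.fract y) = f (y - n) := by
    intro n y h1 h2
    rw [Int.fract, Int.floor_eq_iff.2 ⟨h1, h2⟩]
  refine ⟨fun x => ?_, fun x => ?_⟩
  · refine ((hf.comp_sub ⌊x⌋).1 x).congr_of_eventuallyEq ?_ rfl
    filter_upwards [self_mem_nhdsWithin,
      mem_nhdsWithin_of_mem_nhds (Iio_mem_nhds (Int.lt_floor_add_one x))] with y hy hy'
    exact heq _ _ ((Int.floor_le x).trans hy) hy'
  · obtain ⟨l, hl⟩ := (hf.comp_sub (⌈x⌉ - 1 : ℤ)).2 x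
    refine ⟨l, hl.congr' ?_⟩
    have h1 := Int.ceil_lt_add_one x
    filter_upwards [self_mem_nhdsWithin, mem_nhdsWithin_of_mem_nhds
      (Ioi_mem_nhds (show ((⌈x⌉ - 1 : ℤ) : ℝ) < x by push_cast; linarith))] with y hy hy'
    refine (heq _ _ (le_of_lt hy') ?_).symm
    push_cast
    have := Int.le_ceil x
    have : y < x := hy
    linarith

/-! ### Lebesgue–Stieltjes measures -/

theorem lsMeasure_Ioc {U : ℝ → ℝ} (hU : StrictMono U) (hc : IsCadlag U) (a b : ℝ) :
    lsMeasure U hU (Ioc a b) = ENNReal.ofReal (U b - U a) := by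
  have h : ∀ x, Function.rightLim U x = U x := fun x => (hc.1 x).rightLim_eq
  rw [lsMeasure, StieltjesFunction.measure_Ioc, Monotone.stieltjesFunction_eq,
    Monotone.stieltjesFunction_eq, h, h]

theorem lsMeasure_Ico {V : ℝ → ℝ} (hV : StrictMono V) (hc : IsCaglad V) (a b : ℝ) :
    lsMeasure V hV (Ico a b) = ENNReal.ofReal (V b - V a) := by
  have h : ∀ x, Function.leftLim (Function.rightLim V) x = V x := fun x => by
    rw [leftLim_rightLim (hV.monotone.tendsto_leftLim x), (hc.1 x).leftLim_eq]
  have h' : ∀ x, Function.leftLim hV.monotone.stieltjesFunction x = V x := h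
  rw [lsMeasure, StieltjesFunction.measure_Ico, h', h']

instance instLocallyFiniteLsMeasure (U : ℝ → ℝ) (hU : StrictMono U) :
    IsLocallyFiniteMeasure (lsMeasure U hU) := by
  rw [lsMeasure]; infer_instance

theorem StrictMono.neg_comp_neg {V : ℝ → ℝ} (hV : StrictMono V) :
    StrictMono fun x => -V (-x) := fun _ _ h => neg_lt_neg (hV (neg_lt_neg h))

theorem IsCaglad.neg_comp_neg {V : ℝ → ℝ} (hV : IsCaglad V) : IsCadlag fun x => -V (-x) :=
  hV.comp_neg.neg

/-- The reflection `x ↦ -x` turns the measure of a left-continuous integrator into that of a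
right-continuous one. -/
theorem map_neg_lsMeasure {V : ℝ → ℝ} (hV : StrictMono V) (hc : IsCaglad V) :
    (lsMeasure V hV).map (fun x => -x) = lsMeasure (fun x => -V (-x)) hV.neg_comp_neg := by
  symm
  refine Measure.ext_of_Ioc _ _ fun a b _ => ?_
  rw [Measure.map_apply measurable_neg measurableSet_Ioc, lsMeasure_Ioc _ hc.neg_comp_neg]
  have : (fun x : ℝ => -x) ⁻¹' Ioc a b = Ico (-b) (-a) := by
    ext x
    simp only [mem_preimage, mem_Ioc, mem_Ico]
    constructor <;> rintro ⟨h1, h2⟩ <;> constructor <;> linarith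
  rw [this, lsMeasure_Ico hV hc]
  congr 1
  ring

/-! ### The fundamental theorem of calculus for one-sided derivatives -/

theorem HasLeftDeriv.sub {U f g : ℝ → ℝ} {x l m : ℝ} (hf : HasLeftDeriv U f x l)
    (hg : HasLeftDeriv U g x m) : HasLeftDeriv U (f - g) x (l - m) := by
  refine (Tendsto.sub hf hg).congr fun y => ?_
  simp only [Pi.sub_apply]
  ring

theorem HasRightDeriv.sub {U f g : ℝ → ℝ} {x l m : ℝ} (hf : HasRightDeriv U f x l)
    (hg : HasRightDeriv U g x m) : HasRightDeriv U (f - g) x (l - m) := by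
  refine (Tendsto.sub hf hg).congr fun y => ?_
  simp only [Pi.sub_apply]
  ring

theorem HasLeftDeriv.const_smul {U f : ℝ → ℝ} {x l : ℝ} (hf : HasLeftDeriv U f x l) (c : ℝ) :
    HasLeftDeriv U (c • f) x (c • l) := by
  refine (Tendsto.const_smul hf c).congr fun y => ?_
  simp only [Pi.smul_apply, smul_eq_mul]
  ring

theorem HasRightDeriv.const_smul {U f : ℝ → ℝ} {x l : ℝ} (hf : HasRightDeriv U f x l) (c : ℝ) :
    HasRightDeriv U (c • f) x (c • l) := by
  refine (Tendsto.const_smul hf c).congr fun y => ?_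
  simp only [Pi.smul_apply, smul_eq_mul]
  ring

theorem hasLeftDeriv_const (U : ℝ → ℝ) (c x : ℝ) : HasLeftDeriv U (fun _ => c) x 0 := by
  simp [HasLeftDeriv]

theorem hasRightDeriv_const (U : ℝ → ℝ) (c x : ℝ) : HasRightDeriv U (fun _ => c) x 0 := by
  simp [HasRightDeriv]

/-- A translation that changes the integrator by a constant only carries one-sided derivatives
along. -/
theorem HasLeftDeriv.comp_add {U f : ℝ → ℝ} {x l p c : ℝ} (hU : ∀ x, U (x + p) - U x = c)
    (h : HasLeftDeriv U f (x + p) l) : HasLeftDeriv U (fun y => f (y + p)) x l := by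
  have hc : Tendsto (fun y : ℝ => y + p) (𝓝[<] x) (𝓝[<] (x + p)) := by
    refine tendsto_nhdsWithin_iff.2 ⟨?_, ?_⟩
    · exact ((continuous_add_const p).tendsto x).mono_left nhdsWithin_le_nhds
    · filter_upwards [self_mem_nhdsWithin] with y (hy : y < x)
      exact add_lt_add_left hy p
  refine (Tendsto.comp h hc).congr fun y => ?_
  have h1 := hU x
  have h2 := hU y
  simp only [Function.comp_apply]
  congr 1
  linarith

theorem HasLeftDeriv.unique {U f : ℝ → ℝ} {x l m : ℝ} (h : HasLeftDeriv U f x l)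
    (h' : HasLeftDeriv U f x m) : l = m :=
  tendsto_nhds_unique h h'

/-- Reflection turns right derivatives into left derivatives. -/
theorem hasLeftDeriv_neg_iff {V g : ℝ → ℝ} {x l : ℝ} :
    HasLeftDeriv (fun x => -V (-x)) (fun x => g (-x)) x l ↔ HasRightDeriv V g (-x) (-l) := by
  have key : ∀ y, -((g (-y) - g (-x)) / (-V (-y) - -V (-x))) =
      (g (-y) - g (-x)) / (V (-y) - V (-x)) := fun y => by
    rw [← div_neg]; congr 1; ring
  constructor
  · intro h
    have h1 : Tendsto (fun y : ℝ => -y) (𝓝[>] (-x)) (𝓝[<] x) := by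
      simpa using tendsto_neg_nhdsGT (a := -x)
    refine (Tendsto.neg (Tendsto.comp h h1)).congr fun y => ?_
    simpa using key (-y)
  · intro h
    have h1 : Tendsto (fun y : ℝ => -y) (𝓝[<] x) (𝓝[>] (-x)) := tendsto_neg_nhdsLT
    have h2 := Tendsto.neg (Tendsto.comp h h1)
    rw [neg_neg] at h2
    refine h2.congr fun y => ?_
    simp only [Function.comp_apply]
    rw [← key, neg_neg]

/-- A right-continuous function whose left derivative with respect to an increasing
right-continuous integrator vanishes everywhere is constant. -/
theorem eq_of_hasLeftDeriv_zero {U f : ℝ → ℝ} (hU : StrictMono U) (hUc : IsCadlag U)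
    (hf : IsCadlag f) (h : ∀ x, HasLeftDeriv U f x 0) (a b : ℝ) : f a = f b := by
  wlog hab : a ≤ b generalizing a b
  · exact (this b a (le_of_not_ge hab)).symm
  -- It suffices that the increment of `f` is at most `ε` times that of `U`, for every `ε > 0`.
  suffices H : ∀ ε > 0, |f b - f a| ≤ ε * (U b - U a) by
    have : |f b - f a| ≤ 0 := by
      refine ge_of_tendsto (x := 𝓝[>] (0 : ℝ)) (f := fun ε : ℝ => ε * (U b - U a)) ?_ ?_
      · have : Tendsto (fun ε : ℝ => ε * (U b - U a)) (𝓝 0) (𝓝 (0 * (U b - U a))) :=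
          (continuous_mul_const _).tendsto 0
        rw [zero_mul] at this
        exact this.mono_left nhdsWithin_le_nhds
      · filter_upwards [self_mem_nhdsWithin] with ε hε using H ε hε
    exact (sub_eq_zero.1 (abs_nonpos_iff.1 this)).symm
  intro ε hε
  -- `S` is closed under decreasing limits by right continuity, and its infimum is `a`: otherwise
  -- the left derivative at the infimum would produce a smaller element.
  let S := {x ∈ Icc a b | |f b - f x| - ε * (U b - U x) ≤ 0}
  have hbS : b ∈ S := ⟨right_mem_Icc.2 hab, by simp⟩
  have hbdd : BddBelow S := ⟨a, fun x hx => hx.1.1⟩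
  set z := sInf S with hz
  have hzcl : z ∈ closure S := csInf_mem_closure ⟨b, hbS⟩ hbdd
  have hzI : z ∈ Icc a b := ⟨le_csInf ⟨b, hbS⟩ fun x hx => hx.1.1, csInf_le hbdd hbS⟩
  have hzS : z ∈ S := by
    refine ⟨hzI, ?_⟩
    have hsub : S ⊆ Ici z := fun x hx => csInf_le hbdd hx
    have : (𝓝[S] z).NeBot := mem_closure_iff_nhdsWithin_neBot.1 hzcl
    have hcont : ContinuousWithinAt (fun x => |f b - f x| - ε * (U b - U x)) (Ici z) z :=
      (continuousWithinAt_const.sub (hf.1 z)).abs.sub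
        (continuousWithinAt_const.mul (continuousWithinAt_const.sub (hUc.1 z)))
    refine le_of_tendsto (hcont.mono hsub) ?_
    filter_upwards [self_mem_nhdsWithin] with x hx using hx.2
  rcases hzI.1.eq_or_lt with haz | haz
  · have := hzS.2
    rw [← haz] at this
    linarith
  · exfalso
    have hev := (Tendsto.abs (h z)).eventually_lt_const (show |(0 : ℝ)| < ε by simpa using hε)
    obtain ⟨y, hy, hay, hyz⟩ := (hev.and (Eventually.and
      (eventually_mem_set.2 (mem_nhdsWithin_of_mem_nhds (Ioi_mem_nhds haz)))
      self_mem_nhdsWithin)).exists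
    have hyz' : y < z := hyz
    have hUyz : U y < U z := hU hyz'
    rw [abs_div, abs_of_neg (sub_neg.2 hUyz), div_lt_iff₀ (by linarith)] at hy
    have hyS : y ∈ S := by
      refine ⟨⟨le_of_lt hay, hyz'.le.trans hzI.2⟩, ?_⟩
      have h1 := hzS.2
      have h2 : |f b - f y| ≤ |f b - f z| + |f y - f z| := by
        rw [abs_sub_comm (f y)]; exact abs_sub_le _ _ _
      nlinarith
    exact absurd (csInf_le hbdd hyS) (not_le.2 hyz')

/-- The primitive of a càglàd function with respect to a càdlàg integrator. -/
theorem exists_hasLeftDeriv {U g : ℝ → ℝ} (hU : StrictMono U) (hUc : IsCadlag U)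
    (hg : IsCaglad g) : ∃ f, f 0 = 0 ∧ IsCadlag f ∧ (∀ x, HasLeftDeriv U f x (g x)) ∧
      ∀ a b, a ≤ b → f b - f a = ∫ s in Ioc a b, g s ∂(lsMeasure U hU) := by
  set ν := lsMeasure U hU
  have hint : ∀ a b, IntegrableOn g (Ioc a b) ν := fun a b =>
    (hg.integrableOn ν a b).mono_set Ioc_subset_Icc_self
  have hii : ∀ a b, IntervalIntegrable g ν a b := fun a b => ⟨hint a b, hint b a⟩
  have hsub : ∀ a b, a ≤ b →
      (∫ s in (0 : ℝ)..b, g s ∂ν) - (∫ s in (0 : ℝ)..a, g s ∂ν) = ∫ s in Ioc a b, g s ∂ν := by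
    intro a b hab
    rw [intervalIntegral.integral_interval_sub_left (hii _ _) (hii _ _),
      intervalIntegral.integral_of_le hab]
  refine ⟨fun x => ∫ s in (0 : ℝ)..x, g s ∂ν, by simp, ?_, ?_, hsub⟩
  · refine IsCadlag.of_eventuallyEq fun x =>
      ⟨(fun y => ∫ s in Iic y, g s ∂(ν.restrict (Ioc (x - 1) (x + 1)))) -
        fun _ => -∫ s in (0 : ℝ)..(x - 1), g s ∂ν,
        (isCadlag_integral_Iic (hint _ _)).sub (isCadlag_const _), ?_⟩
    filter_upwards [Ioo_mem_nhds (sub_one_lt x) (lt_add_one x)] with y hy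
    have h1 := hsub (x - 1) y hy.1.le
    have h2 : Iic y ∩ Ioc (x - 1) (x + 1) = Ioc (x - 1) y := by
      ext s
      simp only [mem_inter_iff, mem_Iic, mem_Ioc]
      exact ⟨fun h => ⟨h.2.1, h.1⟩, fun h => ⟨h.2, h.1, h.2.trans hy.2.le⟩⟩
    simp only [Pi.sub_apply]
    rw [Measure.restrict_restrict measurableSet_Iic, h2, ← h1]
    ring
  · intro x
    refine Metric.tendsto_nhds.2 fun ε hε => ?_
    have hev : ∀ᶠ y in 𝓝[≤] x, |g y - g x| ≤ ε / 2 := by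
      filter_upwards [(Metric.tendsto_nhds.1 (hg.1 x).tendsto (ε / 2) (half_pos hε))] with y hy
      exact (Real.dist_eq _ _ ▸ hy).le
    obtain ⟨δ, hδ, hδg⟩ := (mem_nhdsLE_iff_exists_Ioc_subset).1 hev
    filter_upwards [Ioo_mem_nhdsLT hδ] with y hy
    have hUyx : 0 < U x - U y := sub_pos.2 (hU hy.2)
    have hνr : ν.real (Ioc y x) = U x - U y := by
      rw [Measure.real, lsMeasure_Ioc hU hUc, ENNReal.toReal_ofReal hUyx.le]
    have h1 := hsub y x hy.2.le
    have h2 : ∫ s in Ioc y x, (g s - g x) ∂ν =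
        (∫ s in Ioc y x, g s ∂ν) - g x * (U x - U y) := by
      rw [integral_sub (hint y x) (integrableOn_const (measure_Ioc_lt_top.ne)),
        setIntegral_const, hνr, smul_eq_mul]
      ring
    have h3 : ‖∫ s in Ioc y x, (g s - g x) ∂ν‖ ≤ ε / 2 * (U x - U y) := by
      rw [← hνr]
      refine norm_setIntegral_le_of_norm_le_const measure_Ioc_lt_top fun s hs => ?_
      exact hδg ⟨hy.1.trans hs.1, hs.2⟩
    rw [h2, ← h1, Real.norm_eq_abs] at h3
    have h4 : ∀ p q : ℝ, (p - q) / (U y - U x) - g x =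
        (q - p - g x * (U x - U y)) / (U x - U y) := by
      intro p q
      have : U y - U x ≠ 0 := by linarith
      field_simp
      ring
    rw [Real.dist_eq, h4, abs_div, abs_of_pos hUyx, div_lt_iff₀ hUyx]
    nlinarith

/-- A càdlàg function with a càglàd left derivative is the integral of that derivative. -/
theorem sub_eq_setIntegral_Ioc {U f g : ℝ → ℝ} (hU : StrictMono U) (hUc : IsCadlag U)
    (hf : IsCadlag f) (hg : IsCaglad g) (h : ∀ x, HasLeftDeriv U f x (g x)) {a b : ℝ}
    (hab : a ≤ b) : f b - f a = ∫ s in Ioc a b, g s ∂(lsMeasure U hU) := by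
  -- The primitive of `g` has the same left derivative, so that it differs from `f` by a constant.
  obtain ⟨p, -, hp, hp', hpi⟩ := exists_hasLeftDeriv hU hUc hg
  rw [← hpi a b hab]
  have := eq_of_hasLeftDeriv_zero hU hUc (hf.sub hp)
    (fun x => by simpa using (h x).sub (hp' x)) a b
  simp only [Pi.sub_apply] at this
  linarith

theorem setIntegral_Ioc_neg {V h : ℝ → ℝ} (hV : StrictMono V) (hVc : IsCaglad V) (a b : ℝ) :
    ∫ s in Ioc (-b) (-a), h (-s) ∂(lsMeasure _ hV.neg_comp_neg) =
      ∫ s in Ico a b, h s ∂(lsMeasure V hV) := by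
  have hme : MeasurableEmbedding fun x : ℝ => -x :=
    (Homeomorph.neg ℝ).isClosedEmbedding.measurableEmbedding
  rw [← map_neg_lsMeasure hV hVc, hme.setIntegral_map]
  have : (fun x : ℝ => -x) ⁻¹' Ioc (-b) (-a) = Ico a b := by
    ext x
    simp
  rw [this]
  simp

/-- The primitive of a càdlàg function with respect to a càglàd integrator. -/
theorem exists_hasRightDeriv {V h : ℝ → ℝ} (hV : StrictMono V) (hVc : IsCaglad V)
    (hh : IsCadlag h) : ∃ g, IsCaglad g ∧ ∀ x, HasRightDeriv V g x (h x) := by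
  obtain ⟨p, -, hp, hp', -⟩ := exists_hasLeftDeriv hV.neg_comp_neg hVc.neg_comp_neg
    (g := fun x => -h (-x)) hh.neg.comp_neg
  refine ⟨fun x => p (-x), hp.comp_neg, fun x => ?_⟩
  have := hasLeftDeriv_neg_iff (V := V) (g := fun x => p (-x)) (x := -x) (l := -h x)
  simp only [neg_neg] at this
  exact this.1 (by simpa using hp' (-x))

/-- A càglàd function with a càdlàg right derivative is the integral of that derivative. -/
theorem sub_eq_setIntegral_Ico {V g h : ℝ → ℝ} (hV : StrictMono V) (hVc : IsCaglad V)
    (hg : IsCaglad g) (hh : IsCadlag h) (hd : ∀ x, HasRightDeriv V g x (h x)) {a b : ℝ}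
    (hab : a ≤ b) : g b - g a = ∫ s in Ico a b, h s ∂(lsMeasure V hV) := by
  have := sub_eq_setIntegral_Ioc hV.neg_comp_neg hVc.neg_comp_neg hg.comp_neg
    (g := fun x => -h (-x)) hh.neg.comp_neg
    (fun x => hasLeftDeriv_neg_iff.2 (by simpa using hd (-x))) (neg_le_neg hab)
  rw [integral_neg, setIntegral_Ioc_neg hV hVc] at this
  simp only [neg_neg] at this
  linarith

/-- A function with a periodic left derivative is periodic if its increment over one period
vanishes. -/
theorem periodic_of_hasLeftDeriv {U f g : ℝ → ℝ} (hU : StrictMono U) (hUc : IsCadlag U)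
    {c : ℝ} (hUp : ∀ x, U (x + 1) - U x = c) (hf : IsCadlag f)
    (h : ∀ x, HasLeftDeriv U f x (g x)) (hg : Function.Periodic g 1) {a : ℝ}
    (ha : f (a + 1) = f a) : Function.Periodic f 1 := by
  intro x
  have h1 : IsCadlag fun x => f (x + 1) := by simpa using hf.comp_sub (-1)
  have h2 := eq_of_hasLeftDeriv_zero hU hUc (h1.sub hf) (fun x => by
    simpa [hg x] using ((h (x + 1)).comp_add hUp).sub (h x)) x a
  simp only [Pi.sub_apply, ha, sub_self] at h2
  linarith

/-- A function with a periodic right derivative is periodic if its increment over one period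
vanishes. -/
theorem periodic_of_hasRightDeriv {V g h : ℝ → ℝ} (hV : StrictMono V) (hVc : IsCaglad V)
    {c : ℝ} (hVp : ∀ x, V (x + 1) - V x = c) (hg : IsCaglad g)
    (hd : ∀ x, HasRightDeriv V g x (h x)) (hh : Function.Periodic h 1) {a : ℝ}
    (ha : g (a + 1) = g a) : Function.Periodic g 1 := by
  have hr := periodic_of_hasLeftDeriv (f := fun x => g (-x)) (g := fun x => -h (-x))
    (a := -(a + 1)) (c := c) hV.neg_comp_neg hVc.neg_comp_neg (fun x => ?_) hg.comp_neg
    (fun x => hasLeftDeriv_neg_iff.2 (by simpa using hd (-x))) (fun x => ?_) (by simp [ha])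
  · intro x
    simpa using (hr (-(x + 1))).symm
  · have := hVp (-(x + 1))
    simp only [neg_add, neg_add_cancel_right] at this ⊢
    linarith
  · have := hh (-(x + 1))
    simp only [neg_add, neg_add_cancel_right] at this ⊢
    rw [this]

/-! ### The Hilbert space `H_{W,𝒟}([0,1])` and its reproducing kernel -/

section Primitive

variable {W : ℝ → ℝ} {hW : IsCadlagIntegrator W}

theorem IsCadlagIntegrator.map_one_pos (hW : IsCadlagIntegrator W) : 0 < W 1 := by
  simpa [hW.map_zero] using hW.strictMono zero_lt_one

theorem wMeasure_real_Ioc (hW : IsCadlagIntegrator W) {x : ℝ} (hx : x ∈ Icc (0 : ℝ) 1) :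
    (wMeasure W hW).real (Ioc 0 x) = W x := by
  have h : Ioc 0 x ∩ Ioc 0 1 = Ioc 0 x :=
    inter_eq_left.2 fun s hs => ⟨hs.1, hs.2.trans hx.2⟩
  rw [wMeasure, Measure.real, Measure.restrict_apply measurableSet_Ioc, h,
    lsMeasure_Ioc hW.strictMono hW.cadlag, hW.map_zero, sub_zero, ENNReal.toReal_ofReal]
  simpa [hW.map_zero] using hW.strictMono.monotone hx.1

theorem ae_wMeasure_mem (hW : IsCadlagIntegrator W) :
    ∀ᵐ s ∂(wMeasure W hW), s ∈ Ioc (0 : ℝ) 1 :=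
  ae_restrict_mem measurableSet_Ioc

/-- `dW` is carried by `(0, 1]`, so that the primitive is an integral over a half-line. -/
theorem wPrimitive_eq_integral_Iic (hW : IsCadlagIntegrator W) (F : ℝ → ℝ) (x : ℝ) :
    wPrimitive W hW F x = ∫ s in Iic x, F s ∂(wMeasure W hW) := by
  refine setIntegral_congr_set (eventuallyEq_set.2 ((ae_wMeasure_mem hW).mono fun s hs => ?_))
  simp [hs.1]

theorem setIntegral_Iic_wMeasure (hW : IsCadlagIntegrator W) (F : ℝ → ℝ) {x : ℝ} (hx : 1 ≤ x) :
    ∫ s in Iic x, F s ∂(wMeasure W hW) = ∫ s, F s ∂(wMeasure W hW) :=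
  setIntegral_eq_integral_of_ae_compl_eq_zero
    ((ae_wMeasure_mem hW).mono fun _ hs h => absurd (hs.2.trans hx) h)

theorem isCadlag_wPrimitive {F : ℝ → ℝ} (hF : Integrable F (wMeasure W hW)) :
    IsCadlag (wPrimitive W hW F) := by
  rw [funext (wPrimitive_eq_integral_Iic hW F)]
  exact isCadlag_integral_Iic hF

theorem wPrimitive_of_nonpos (hW : IsCadlagIntegrator W) (F : ℝ → ℝ) {x : ℝ} (hx : x ≤ 0) :
    wPrimitive W hW F x = 0 := by
  simp [wPrimitive, Ioc_eq_empty (not_lt.2 hx)]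

theorem MemL2Zero.wPrimitive_of_one_le {F : ℝ → ℝ} (hF : MemL2Zero W hW F) {x : ℝ}
    (hx : 1 ≤ x) : wPrimitive W hW F x = 0 := by
  rw [wPrimitive_eq_integral_Iic, setIntegral_Iic_wMeasure hW F hx, hF.2]

theorem IsWDeriv.iccExtend_eq {f : I → ℝ} {F : ℝ → ℝ} (hf : IsWDeriv W hW f F) :
    IccExtend zero_le_one f = wPrimitive W hW F := by
  funext x
  rcases le_or_gt x 0 with h0 | h0
  · rw [IccExtend_of_le_left _ _ h0, hf.2, wPrimitive_of_nonpos _ _ h0,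
      wPrimitive_of_nonpos _ _ le_rfl]
  · rcases le_or_gt 1 x with h1 | h1
    · rw [IccExtend_of_right_le _ _ h1, hf.2, hf.1.wPrimitive_of_one_le h1,
        hf.1.wPrimitive_of_one_le le_rfl]
    · rw [IccExtend_of_mem _ _ ⟨h0.le, h1.le⟩, hf.2]

end Primitive

namespace DirichletSpace

variable {W : ℝ → ℝ} {hW : IsCadlagIntegrator W}

@[ext]
theorem ext {f g : DirichletSpace W hW} (h : ∀ t, f.toFun t = g.toFun t) : f = g :=
  Subtype.ext (funext h)

@[simp] theorem toFun_sub (f g : DirichletSpace W hW) : (f - g).toFun = f.toFun - g.toFun := rfl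

@[simp] theorem toFun_smul (c : ℝ) (f : DirichletSpace W hW) : (c • f).toFun = c • f.toFun := rfl

/-- The element of `H_{W,𝒟}([0,1])` with generalized derivative `F`. -/
def ofDeriv (F : ℝ → ℝ) (hF : MemL2Zero W hW F) : DirichletSpace W hW :=
  ⟨fun x => wPrimitive W hW F x, by
    have hc := isCadlag_wPrimitive hF.integrable
    refine ⟨⟨fun x => ?_, fun x => ?_⟩, wPrimitive_of_nonpos hW F le_rfl,
      hF.wPrimitive_of_one_le le_rfl, F, hF, fun x => rfl⟩
    · exact (hc.1 x).comp continuous_subtype_val.continuousWithinAt fun y hy => hy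
    · obtain ⟨l, hl⟩ := hc.2 x
      refine ⟨l, hl.comp (tendsto_nhdsWithin_iff.2
        ⟨(continuous_subtype_val.tendsto x).mono_left nhdsWithin_le_nhds, ?_⟩)⟩
      filter_upwards [self_mem_nhdsWithin] with y hy using hy⟩

theorem isWDeriv_ofDeriv (F : ℝ → ℝ) (hF : MemL2Zero W hW F) :
    IsWDeriv W hW (ofDeriv F hF).toFun F :=
  ⟨hF, fun _ => rfl⟩

theorem inner_eq_integral {f g : DirichletSpace W hW} {F G : ℝ → ℝ}
    (hF : IsWDeriv W hW f.toFun F) (hG : IsWDeriv W hW g.toFun G) :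
    inner ℝ f g = ∫ s, F s * G s ∂(wMeasure W hW) := by
  change ∫ s, f.deriv s * g.deriv s ∂(wMeasure W hW) = _
  refine integral_congr_ae ?_
  filter_upwards [f.isWDeriv_deriv.ae_eq hF, g.isWDeriv_deriv.ae_eq hG] with s h1 h2
  rw [h1, h2]

/-- The generalized derivative, as an isometry into `L²(dW)`. -/
def derivL2 : DirichletSpace W hW →ₗᵢ[ℝ] Lp ℝ 2 (wMeasure W hW) :=
  LinearMap.isometryOfInner
    { toFun := fun f => f.isWDeriv_deriv.1.1.toLp f.deriv
      map_add' := fun f g => by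
        rw [← MemLp.toLp_add]
        exact MemLp.toLp_congr _ _
          ((f + g).isWDeriv_deriv.ae_eq (f.isWDeriv_deriv.add g.isWDeriv_deriv))
      map_smul' := fun c f => by
        rw [RingHom.id_apply, ← MemLp.toLp_const_smul]
        exact MemLp.toLp_congr _ _
          ((c • f).isWDeriv_deriv.ae_eq (f.isWDeriv_deriv.smul c)) }
    fun f g => by
      rw [inner_eq_integral f.isWDeriv_deriv g.isWDeriv_deriv, L2.inner_def]
      refine integral_congr_ae ?_
      filter_upwards [f.isWDeriv_deriv.1.1.coeFn_toLp, g.isWDeriv_deriv.1.1.coeFn_toLp]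
        with s h1 h2
      simp only [LinearMap.coe_mk, AddHom.coe_mk]
      rw [h1, h2]
      simp [mul_comm]

theorem range_derivL2 : range (derivL2 (hW := hW)) =
    {u | inner ℝ ((memLp_const (1 : ℝ)).toLp (fun _ => (1 : ℝ))) u = 0} := by
  have key : ∀ u : Lp ℝ 2 (wMeasure W hW),
      inner ℝ ((memLp_const (1 : ℝ)).toLp (fun _ => (1 : ℝ))) u =
        ∫ s, u s ∂(wMeasure W hW) := by
    intro u
    rw [L2.inner_def]
    refine integral_congr_ae ?_
    filter_upwards [(memLp_const (1 : ℝ) (p := 2) (μ := wMeasure W hW)).coeFn_toLp] with s hs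
    rw [hs]
    simp
  ext u
  rw [mem_ofPred_eq, key]
  constructor
  · rintro ⟨f, rfl⟩
    refine (integral_congr_ae f.isWDeriv_deriv.1.1.coeFn_toLp).trans ?_
    exact f.isWDeriv_deriv.1.2
  · intro hu
    have hF : MemL2Zero W hW u := ⟨Lp.memLp u, hu⟩
    refine ⟨ofDeriv u hF, Lp.ext ?_⟩
    exact ((ofDeriv _ hF).isWDeriv_deriv.1.1.coeFn_toLp).trans
      ((ofDeriv _ hF).isWDeriv_deriv.ae_eq (isWDeriv_ofDeriv _ hF))

instance instCompleteSpace : CompleteSpace (DirichletSpace W hW) := by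
  refine (completeSpace_iff_isComplete_range (derivL2 (hW := hW)).isometry.isUniformInducing).2 ?_
  refine IsClosed.isComplete ?_
  rw [range_derivL2]
  exact isClosed_eq (by fun_prop) continuous_const

/-- The generalized derivative `1_{(0, t]} - W(t) / W(1)` of the kernel function at `t`. -/
def kernelDeriv (W : ℝ → ℝ) (t : I) : ℝ → ℝ :=
  (Ioc 0 (t : ℝ)).indicator (fun _ => (1 : ℝ)) - fun _ => W t / W 1

theorem integral_mul_kernelDeriv {F : ℝ → ℝ} (hF : Integrable F (wMeasure W hW)) (t : I) :
    ∫ s, F s * kernelDeriv W t s ∂(wMeasure W hW) =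
      wPrimitive W hW F t - (∫ s, F s ∂(wMeasure W hW)) * (W t / W 1) := by
  have h : ∀ s, F s * kernelDeriv W t s = (Ioc 0 (t : ℝ)).indicator F s - F s * (W t / W 1) := by
    intro s
    by_cases hs : s ∈ Ioc 0 (t : ℝ) <;> simp [kernelDeriv, hs, mul_sub]
  simp_rw [h]
  rw [integral_sub (hF.indicator measurableSet_Ioc) (hF.mul_const _),
    integral_indicator measurableSet_Ioc, integral_mul_const, wPrimitive]

theorem wPrimitive_kernelDeriv (hW : IsCadlagIntegrator W) (s t : I) :
    wPrimitive W hW (kernelDeriv W t) s = bridgeKernel W s t := by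
  have hi : Ioc 0 (t : ℝ) ∩ Ioc 0 (s : ℝ) = Ioc 0 (min (s : ℝ) t) := by
    rw [Ioc_inter_Ioc, max_self, min_comm]
  simp only [wPrimitive, kernelDeriv, Pi.sub_apply]
  rw [integral_sub ((integrable_const _).indicator measurableSet_Ioc) (integrable_const _),
    setIntegral_const, wMeasure_real_Ioc hW s.2, integral_indicator measurableSet_Ioc,
    Measure.restrict_restrict measurableSet_Ioc, hi, setIntegral_const,
    wMeasure_real_Ioc hW ⟨le_min s.2.1 t.2.1, (min_le_left _ _).trans s.2.2⟩, bridgeKernel]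
  simp only [smul_eq_mul, mul_one]
  ring

theorem memL2Zero_kernelDeriv (hW : IsCadlagIntegrator W) (t : I) :
    MemL2Zero W hW (kernelDeriv W t) := by
  refine ⟨((memLp_const (1 : ℝ)).indicator measurableSet_Ioc).sub (memLp_const (W t / W 1)), ?_⟩
  have h := wPrimitive_kernelDeriv hW 1 t
  rw [wPrimitive_eq_integral_Iic, Icc.coe_one, setIntegral_Iic_wMeasure hW _ le_rfl] at h
  rw [h, bridgeKernel, Icc.coe_one, min_eq_right t.2.2,
    mul_div_cancel_left₀ _ hW.map_one_pos.ne', sub_self]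

/-- The kernel function `ϱ_{W,0}(·, t)` as an element of `H_{W,𝒟}([0,1])`. -/
def kernelFun (hW : IsCadlagIntegrator W) (t : I) : DirichletSpace W hW :=
  ofDeriv (kernelDeriv W t) (memL2Zero_kernelDeriv hW t)

theorem kernelFun_apply (hW : IsCadlagIntegrator W) (s t : I) :
    (kernelFun hW t).toFun s = bridgeKernel W s t :=
  wPrimitive_kernelDeriv hW s t

/-- The reproducing property: the derivative of `f` has mean zero, so that pairing it with
`1_{(0, t]} - W(t) / W(1)` integrates it over `(0, t]`. -/
theorem inner_kernelFun (f : DirichletSpace W hW) (t : I) :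
    inner ℝ f (kernelFun hW t) = f.toFun t := by
  rw [inner_eq_integral (g := kernelFun hW t) f.isWDeriv_deriv
    (isWDeriv_ofDeriv _ (memL2Zero_kernelDeriv hW t)),
    integral_mul_kernelDeriv f.isWDeriv_deriv.1.integrable, f.isWDeriv_deriv.1.2, zero_mul,
    sub_zero, f.isWDeriv_deriv.2]

theorem span_kernelFun_topologicalClosure :
    (Submodule.span ℝ (range (kernelFun hW))).topologicalClosure = ⊤ := by
  rw [Submodule.topologicalClosure_eq_top_iff]
  refine (Submodule.eq_bot_iff _).2 fun f hf => ext fun t => ?_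
  rw [← inner_kernelFun]
  exact (Submodule.mem_orthogonal' _ _).1 hf _ (Submodule.subset_span ⟨t, rfl⟩)

theorem abs_toFun_le (f : DirichletSpace W hW) (t : I) : |f.toFun t| ≤ ‖f‖ * √(W 1) := by
  rw [← inner_kernelFun]
  refine (abs_real_inner_le_norm _ _).trans (mul_le_mul_of_nonneg_left ?_ (norm_nonneg _))
  refine Real.le_sqrt_of_sq_le ?_
  rw [← real_inner_self_eq_norm_sq, inner_kernelFun, kernelFun_apply, bridgeKernel, min_self]
  have h1 : W t ≤ W 1 := hW.strictMono.monotone t.2.2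
  have h2 : 0 ≤ W t * W t / W 1 := div_nonneg (mul_self_nonneg _) hW.map_one_pos.le
  linarith

/-- `H_{W,𝒟}([0,1])` is a reproducing kernel Hilbert space: evaluation at `t` is the pairing with
the kernel function at `t`. -/
@[reducible] def rkhs (hW : IsCadlagIntegrator W) : RKHS ℝ (DirichletSpace W hW) I ℝ where
  coeCLM := ContinuousLinearMap.pi fun t => innerSL ℝ (kernelFun hW t)
  coeCLM_injective f g h := ext fun t => by
    rw [← inner_kernelFun, ← inner_kernelFun, real_inner_comm, real_inner_comm _ g]
    exact congrFun h t

theorem rkhs_coe (f : DirichletSpace W hW) :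
    letI := rkhs hW
    ⇑f = f.toFun := by
  funext t
  rw [← inner_kernelFun, real_inner_comm]
  rfl

theorem rkhs_kernel (hW : IsCadlagIntegrator W) (s t : I) :
    letI := rkhs hW
    RKHS.kernel (DirichletSpace W hW) s t 1 = bridgeKernel W s t := by
  let _ := rkhs hW
  have h : RKHS.kerFun (DirichletSpace W hW) t (1 : ℝ) = kernelFun hW t := by
    refine ext_inner_left ℝ fun f => ?_
    rw [RKHS.inner_kerFun, inner_kernelFun, rkhs_coe]
    simp
  rw [← RKHS.kerFun_apply, h, rkhs_coe, kernelFun_apply]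

end DirichletSpace

/-! ### The Cameron–Martin space -/

/-- Two total families in Hilbert spaces with the same Gram matrix are related by a unitary
operator. -/
theorem exists_linearIsometryEquiv_of_inner_eq {T E F : Type*} [NormedAddCommGroup E]
    [InnerProductSpace ℝ E] [CompleteSpace E] [NormedAddCommGroup F] [InnerProductSpace ℝ F]
    [CompleteSpace F] (x : T → E) (y : T → F)
    (hx : (Submodule.span ℝ (range x)).topologicalClosure = ⊤)
    (hy : (Submodule.span ℝ (range y)).topologicalClosure = ⊤)
    (hxy : ∀ s t, inner ℝ (x s) (x t) = inner ℝ (y s) (y t)) :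
    ∃ U : E ≃ₗᵢ[ℝ] F, ∀ t, U (x t) = y t := by
  let a : (T →₀ ℝ) →ₗ[ℝ] E := Finsupp.linearCombination ℝ x
  let b : (T →₀ ℝ) →ₗ[ℝ] F := Finsupp.linearCombination ℝ y
  have ha : DenseRange a := by
    rw [DenseRange, ← LinearMap.coe_range, Finsupp.range_linearCombination]
    exact (Submodule.dense_iff_topologicalClosure_eq_top).2 hx
  have hb : DenseRange b := by
    rw [DenseRange, ← LinearMap.coe_range, Finsupp.range_linearCombination]
    exact (Submodule.dense_iff_topologicalClosure_eq_top).2 hy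
  have hab : ∀ c, ‖b c‖ = ‖a c‖ := by
    intro c
    rw [@norm_eq_sqrt_real_inner F, @norm_eq_sqrt_real_inner E]
    simp only [a, b, Finsupp.linearCombination_apply, Finsupp.sum, sum_inner, inner_sum,
      real_inner_smul_left, real_inner_smul_right, hxy]
  let U := (LinearEquiv.refl ℝ (T →₀ ℝ)).extend a b ha ⟨1, fun c => by simp [hab]⟩ hb
    ⟨1, fun c => by simp [hab]⟩
  have hU : ∀ c, U (a c) = b c := fun c => LinearEquiv.extend_eq _ a b _ _ _ _ c
  refine ⟨⟨U.toLinearEquiv, fun v => ?_⟩, fun t => ?_⟩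
  · change ‖U v‖ = ‖v‖
    refine ha.induction_on v (isClosed_eq (by fun_prop) (by fun_prop)) fun c => ?_
    rw [hU, hab]
  · simpa [a, b] using hU (Finsupp.single t 1)

theorem IsWBrownianBridge.inner_toLp {W : ℝ → ℝ} {Ω : Type*} [MeasurableSpace Ω]
    {X : I → Ω → ℝ} {P : Measure Ω} [IsProbabilityMeasure P] (h : IsWBrownianBridge W X P)
    (s t : I) : inner ℝ ((h.memLp s).toLp (X s)) ((h.memLp t).toLp (X t)) = bridgeKernel W s t := by
  rw [← h.covariance, covariance_eq_sub (h.memLp s) (h.memLp t), h.centered s, zero_mul, sub_zero,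
    L2.inner_def]
  refine integral_congr_ae ?_
  filter_upwards [(h.memLp s).coeFn_toLp, (h.memLp t).coeFn_toLp] with ω h1 h2
  rw [h1, h2]
  simp [mul_comm]

/-- The closed span of the bridge and `H_{W,𝒟}([0,1])` are spanned by families with the same Gram
matrix, the bridge and the kernel functions. The unitary operator that maps one to the other sends
`ξ` to the function `t ↦ E[ξ X_t]` because of the reproducing property. -/
theorem IsWBrownianBridge.exists_linearIsometryEquiv {W : ℝ → ℝ} (hW : IsCadlagIntegrator W)
    {Ω : Type*} [MeasurableSpace Ω] {X : I → Ω → ℝ} {P : Measure Ω} [IsProbabilityMeasure P]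
    (h : IsWBrownianBridge W X P) :
    ∃ e : CameronMartinSpace X P h.memLp ≃ₗᵢ[ℝ] DirichletSpace W hW,
      ∀ f, (e f).toFun = f.toFun := by
  have hcomplete : CompleteSpace (processSpan X P h.memLp) :=
    (Submodule.isClosed_topologicalClosure _).completeSpace_coe
  let x : I → processSpan X P h.memLp := fun t =>
    ⟨(h.memLp t).toLp (X t), Submodule.le_topologicalClosure _ (Submodule.subset_span ⟨t, rfl⟩)⟩
  have hx : (Submodule.span ℝ (range x)).topologicalClosure = ⊤ := by
    rw [Submodule.topologicalClosure_eq_top_iff]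
    refine (Submodule.eq_bot_iff _).2 fun ξ hξ => ?_
    refine cameronMartinMap_injective X P h.memLp ?_
    rw [map_zero]
    funext t
    exact (Submodule.mem_orthogonal' _ _).1 hξ (x t) (Submodule.subset_span ⟨t, rfl⟩)
  obtain ⟨U, hU⟩ := exists_linearIsometryEquiv_of_inner_eq x (DirichletSpace.kernelFun hW) hx
    DirichletSpace.span_kernelFun_topologicalClosure fun s t => by
      rw [real_inner_comm, DirichletSpace.inner_kernelFun, DirichletSpace.kernelFun_apply]
      exact h.inner_toLp t s
  have hnorm : ∀ f : CameronMartinSpace X P h.memLp, ‖CameronMartinSpace.repr f‖ = ‖f‖ := by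
    intro f
    rw [norm_eq_sqrt_real_inner, @norm_eq_sqrt_real_inner (CameronMartinSpace X P h.memLp)]
    rfl
  refine ⟨(LinearIsometryEquiv.mk CameronMartinSpace.repr hnorm).trans U, fun f => ?_⟩
  funext t
  obtain ⟨ξ, rfl⟩ := CameronMartinSpace.repr.symm.surjective f
  have h1 : (CameronMartinSpace.repr.symm ξ).toFun t = inner ℝ ξ (x t) := rfl
  rw [h1, ← U.inner_map_map, hU, DirichletSpace.inner_kernelFun]
  simp

/-! ### Integration by parts on the torus -/

instance instFiniteVMeasure (V : ℝ → ℝ) (hV : IsCagladIntegrator V) :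
    IsFiniteMeasure (vMeasure V hV) := by
  refine ⟨?_⟩
  rw [vMeasure, Measure.restrict_apply_univ, lsMeasure_Ico hV.strictMono hV.caglad]
  exact ENNReal.ofReal_lt_top

theorem ae_vMeasure_mem {V : ℝ → ℝ} (hV : IsCagladIntegrator V) :
    ∀ᵐ s ∂(vMeasure V hV), s ∈ Ico (0 : ℝ) 1 :=
  ae_restrict_mem measurableSet_Ico

theorem setIntegral_Iio_one_vMeasure {V : ℝ → ℝ} (hV : IsCagladIntegrator V) (h : ℝ → ℝ) :
    ∫ s in Iio 1, h s ∂(vMeasure V hV) = ∫ s, h s ∂(vMeasure V hV) :=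
  setIntegral_eq_integral_of_ae_compl_eq_zero
    ((ae_vMeasure_mem hV).mono fun _ hs h => absurd hs.2 h)

/-- `dV` charges every interval `[x, x + δ)`, so that a càdlàg function is determined on `[0, 1)`
by its class. -/
theorem IsCadlag.eqOn_of_ae_eq {V : ℝ → ℝ} {hV : IsCagladIntegrator V} {f g : ℝ → ℝ}
    (hf : IsCadlag f) (hg : IsCadlag g) (hfg : f =ᵐ[vMeasure V hV] g) : EqOn f g (Ico 0 1) := by
  intro x hx
  by_contra hne
  have h1 : ContinuousWithinAt (fun y => f y - g y) (Ici x) x := (hf.1 x).sub (hg.1 x)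
  have h2 : ∀ᶠ y in 𝓝[≥] x, f y - g y ≠ 0 := h1.eventually_ne (sub_ne_zero.2 hne)
  obtain ⟨δ, hδ, hδs⟩ := mem_nhdsGE_iff_exists_Ico_subset.1 h2
  have hlt : x < min δ 1 := lt_min hδ hx.2
  have h3 : vMeasure V hV (Ico x (min δ 1)) = 0 := by
    refine measure_mono_null (fun y hy => ?_) (ae_iff.1 hfg)
    have := hδs ⟨hy.1, hy.2.trans_le (min_le_left _ _)⟩
    exact fun h => this (sub_eq_zero.2 h)
  have hi : Ico x (min δ 1) ∩ Ico 0 1 = Ico x (min δ 1) :=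
    inter_eq_left.2 fun s hs => ⟨hx.1.trans hs.1, hs.2.trans_le (min_le_right _ _)⟩
  rw [vMeasure, Measure.restrict_apply measurableSet_Ico, hi,
    lsMeasure_Ico hV.strictMono hV.caglad, ENNReal.ofReal_eq_zero] at h3
  have := hV.strictMono hlt
  linarith

theorem IsCadlag.memLp_vMeasure {V : ℝ → ℝ} (hV : IsCagladIntegrator V) {f : ℝ → ℝ}
    (hf : IsCadlag f) : MemLp f 2 (vMeasure V hV) := by
  obtain ⟨C, hC⟩ := hf.bounded 0 1
  exact MemLp.of_bound hf.measurable.aestronglyMeasurable C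
    ((ae_vMeasure_mem hV).mono fun s hs => hC s ⟨hs.1, hs.2.le⟩)

theorem IsCadlag.integrable_vMeasure {V : ℝ → ℝ} (hV : IsCagladIntegrator V) {f : ℝ → ℝ}
    (hf : IsCadlag f) : Integrable f (vMeasure V hV) :=
  (hf.memLp_vMeasure hV).integrable (by norm_num)

theorem IsCaglad.memLp_wMeasure {W : ℝ → ℝ} (hW : IsCadlagIntegrator W) {f : ℝ → ℝ}
    (hf : IsCaglad f) : MemLp f 2 (wMeasure W hW) := by
  obtain ⟨C, hC⟩ := hf.bounded 0 1
  exact MemLp.of_bound hf.measurable.aestronglyMeasurable C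
    ((ae_wMeasure_mem hW).mono fun s hs => hC s ⟨hs.1.le, hs.2⟩)

theorem integral_mul_setIntegral_Iio {μ ν : Measure ℝ} [SFinite μ] [SFinite ν] {F h : ℝ → ℝ}
    (hF : Integrable F μ) (hh : Integrable h ν) :
    ∫ x, F x * ∫ y in Iio x, h y ∂ν ∂μ = ∫ y, h y * ∫ x in Ioi y, F x ∂μ ∂ν := by
  have hm : MeasurableSet {p : ℝ × ℝ | p.2 < p.1} := measurableSet_lt measurable_snd measurable_fst
  have hint : Integrable (fun p : ℝ × ℝ => {p : ℝ × ℝ | p.2 < p.1}.indicator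
      (fun p => F p.1 * h p.2) p) (μ.prod ν) := (hF.mul_prod hh).indicator hm
  have hswap := integral_integral_swap (f := fun x y => {p : ℝ × ℝ | p.2 < p.1}.indicator
      (fun p => F p.1 * h p.2) (x, y)) hint
  have h1 : ∀ x, F x * ∫ y in Iio x, h y ∂ν =
      ∫ y, {p : ℝ × ℝ | p.2 < p.1}.indicator (fun p => F p.1 * h p.2) (x, y) ∂ν := by
    intro x
    rw [← integral_indicator measurableSet_Iio, ← integral_const_mul]
    refine integral_congr_ae (ae_of_all _ fun y => ?_)
    by_cases hxy : y < x <;> simp [indicator, hxy]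
  have h2 : ∀ y, h y * ∫ x in Ioi y, F x ∂μ =
      ∫ x, {p : ℝ × ℝ | p.2 < p.1}.indicator (fun p => F p.1 * h p.2) (x, y) ∂μ := by
    intro y
    rw [← integral_indicator measurableSet_Ioi, ← integral_const_mul]
    refine integral_congr_ae (ae_of_all _ fun x => ?_)
    by_cases hxy : y < x <;> simp [indicator, hxy, mul_comm]
  simp_rw [h1, h2]
  exact hswap

section Torus

variable {W V : ℝ → ℝ} {hW : IsCadlagIntegrator W} {hV : IsCagladIntegrator V}

theorem sub_eq_setIntegral_Iio {g h : ℝ → ℝ} (hg : IsCaglad g) (hh : IsCadlag h)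
    (hd : ∀ x, HasRightDeriv V g x (h x)) {x : ℝ} (hx : x ∈ Icc (0 : ℝ) 1) :
    g x - g 0 = ∫ y in Iio x, h y ∂(vMeasure V hV) := by
  have hi : Iio x ∩ Ico 0 1 = Ico 0 x := by
    ext s
    simp only [mem_inter_iff, mem_Iio, mem_Ico]
    exact ⟨fun h => ⟨h.2.1, h.1⟩, fun h => ⟨h.2, h.1, h.2.trans_le hx.2⟩⟩
  rw [vMeasure, Measure.restrict_restrict measurableSet_Iio, hi]
  exact sub_eq_setIntegral_Ico hV.strictMono hV.caglad hg hh hd hx.1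

/-- Integration by parts. The boundary terms vanish because `F` has mean zero. -/
theorem MemL2Zero.integral_mul_eq_neg {F g h : ℝ → ℝ} (hF : MemL2Zero W hW F) (hg : IsCaglad g)
    (hh : IsCadlag h) (hd : ∀ x, HasRightDeriv V g x (h x)) :
    ∫ s, F s * g s ∂(wMeasure W hW) = -∫ y, h y * wPrimitive W hW F y ∂(vMeasure V hV) := by
  have hFg : Integrable (fun s => F s * g s) (wMeasure W hW) :=
    hF.1.integrable_mul (hg.memLp_wMeasure hW)
  have h1 : (fun s => F s * (g s - g 0)) =ᵐ[wMeasure W hW]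
      fun s => F s * ∫ y in Iio s, h y ∂(vMeasure V hV) := by
    filter_upwards [ae_wMeasure_mem hW] with s hs
    rw [sub_eq_setIntegral_Iio (hV := hV) hg hh hd ⟨hs.1.le, hs.2⟩]
  have h2 : ∫ s, F s * (g s - g 0) ∂(wMeasure W hW) = ∫ s, F s * g s ∂(wMeasure W hW) := by
    simp_rw [mul_sub]
    rw [integral_sub hFg (hF.integrable.mul_const _), integral_mul_const, hF.2, zero_mul, sub_zero]
  have h3 : ∀ y, ∫ x in Ioi y, F x ∂(wMeasure W hW) = -wPrimitive W hW F y := by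
    intro y
    have := integral_add_compl (measurableSet_Iic (a := y)) hF.integrable
    rw [compl_Iic, hF.2, ← wPrimitive_eq_integral_Iic] at this
    linarith
  rw [← h2, integral_congr_ae h1, integral_mul_setIntegral_Iio hF.integrable
    (hh.integrable_vMeasure hV)]
  simp_rw [h3, mul_neg]
  rw [integral_neg]

/-! ### The strong domain -/

namespace IsStrong

variable {f g h f' g' h' : ℝ → ℝ}

theorem sub (hf : IsStrong W V f g h) (hf' : IsStrong W V f' g' h') :
    IsStrong W V (f - f') (g - g') (h - h') where
  periodic := hf.periodic.sub hf'.periodic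
  cadlag := hf.cadlag.sub hf'.cadlag
  left_deriv x := (hf.left_deriv x).sub (hf'.left_deriv x)
  caglad_deriv := hf.caglad_deriv.sub hf'.caglad_deriv
  right_deriv x := (hf.right_deriv x).sub (hf'.right_deriv x)
  cadlag_deriv := hf.cadlag_deriv.sub hf'.cadlag_deriv

theorem const_smul (hf : IsStrong W V f g h) (c : ℝ) :
    IsStrong W V (c • f) (c • g) (c • h) where
  periodic := hf.periodic.smul c
  cadlag := hf.cadlag.const_smul c
  left_deriv x := (hf.left_deriv x).const_smul c
  caglad_deriv := hf.caglad_deriv.const_smul c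
  right_deriv x := (hf.right_deriv x).const_smul c
  cadlag_deriv := hf.cadlag_deriv.const_smul c

theorem wPrimitive_eq (hW : IsCadlagIntegrator W) (hf : IsStrong W V f g h) {x : ℝ}
    (hx : x ∈ Icc (0 : ℝ) 1) : wPrimitive W hW g x = f x - f 0 := by
  have hi : Ioc 0 x ∩ Ioc 0 1 = Ioc 0 x :=
    inter_eq_left.2 fun s hs => ⟨hs.1, hs.2.trans hx.2⟩
  rw [sub_eq_setIntegral_Ioc hW.strictMono hW.cadlag hf.cadlag hf.caglad_deriv hf.left_deriv hx.1,
    wPrimitive, wMeasure, Measure.restrict_restrict measurableSet_Ioc, hi]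

theorem memL2Zero (hW : IsCadlagIntegrator W) (hf : IsStrong W V f g h) : MemL2Zero W hW g := by
  refine ⟨hf.caglad_deriv.memLp_wMeasure hW, ?_⟩
  have h1 := hf.wPrimitive_eq hW (right_mem_Icc.2 zero_le_one)
  have h2 := hf.periodic 0
  rw [zero_add] at h2
  rw [h2, sub_self, wPrimitive_eq_integral_Iic, setIntegral_Iic_wMeasure hW g le_rfl] at h1
  exact h1

/-- The left derivative of a function on the torus is a function on the torus. -/
theorem periodic_deriv (hW : IsCadlagIntegrator W) (hf : IsStrong W V f g h) :
    Function.Periodic g 1 := by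
  intro x
  have h1 := (hf.left_deriv (x + 1)).comp_add hW.periodic
  rw [funext hf.periodic] at h1
  exact h1.unique (hf.left_deriv x)

theorem integral_eq_zero (hW : IsCadlagIntegrator W) (hV : IsCagladIntegrator V)
    (hf : IsStrong W V f g h) : ∫ y, h y ∂(vMeasure V hV) = 0 := by
  have h1 := sub_eq_setIntegral_Iio (hV := hV) hf.caglad_deriv hf.cadlag_deriv hf.right_deriv
    (right_mem_Icc.2 zero_le_one)
  have h2 := hf.periodic_deriv hW 0
  rw [zero_add] at h2
  rw [h2, sub_self, setIntegral_Iio_one_vMeasure] at h1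
  exact h1.symm

/-- The element `f - f(0)` of `H_{W,𝒟}([0,1])`. -/
def toDirichlet (hW : IsCadlagIntegrator W) (hf : IsStrong W V f g h) : DirichletSpace W hW :=
  DirichletSpace.ofDeriv g (hf.memL2Zero hW)

theorem toFun_toDirichlet (hW : IsCadlagIntegrator W) (hf : IsStrong W V f g h) (t : I) :
    (hf.toDirichlet hW).toFun t = f t - f 0 :=
  hf.wPrimitive_eq hW t.2

theorem toDirichlet_sub (hW : IsCadlagIntegrator W) (hf : IsStrong W V f g h)
    (hf' : IsStrong W V f' g' h') :
    (hf.sub hf').toDirichlet hW = hf.toDirichlet hW - hf'.toDirichlet hW := by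
  ext t
  simp only [toFun_toDirichlet, DirichletSpace.toFun_sub, Pi.sub_apply]
  ring

theorem toDirichlet_const_smul (hW : IsCadlagIntegrator W) (hf : IsStrong W V f g h) (c : ℝ) :
    (hf.const_smul c).toDirichlet hW = c • hf.toDirichlet hW := by
  ext t
  simp only [toFun_toDirichlet, DirichletSpace.toFun_smul, Pi.smul_apply, smul_eq_mul]
  ring

theorem inner_toDirichlet (hf : IsStrong W V f g h) (φ : DirichletSpace W hW) :
    inner ℝ φ (hf.toDirichlet hW) =
      -∫ y, h y * wPrimitive W hW φ.deriv y ∂(vMeasure V hV) := by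
  rw [DirichletSpace.inner_eq_integral (g := hf.toDirichlet hW) φ.isWDeriv_deriv
    (DirichletSpace.isWDeriv_ofDeriv g (hf.memL2Zero hW))]
  exact φ.isWDeriv_deriv.1.integral_mul_eq_neg hf.caglad_deriv hf.cadlag_deriv hf.right_deriv

/-- The energetic norm is a Sobolev norm: `⟨(I - D_V⁺ D_W⁻) f, f⟩_V = ‖f‖_V² + ‖D_W⁻ f‖_W²`. -/
theorem energy_eq (hW : IsCadlagIntegrator W) (hV : IsCagladIntegrator V)
    (hf : IsStrong W V f g h) :
    energy V hV f h = ∫ x, f x * f x ∂(vMeasure V hV) + ‖hf.toDirichlet hW‖ ^ 2 := by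
  have hff : Integrable (fun x => f x * f x) (vMeasure V hV) :=
    (hf.cadlag.memLp_vMeasure hV).integrable_mul (hf.cadlag.memLp_vMeasure hV)
  have hhf : Integrable (fun x => h x * f x) (vMeasure V hV) :=
    (hf.cadlag_deriv.memLp_vMeasure hV).integrable_mul (hf.cadlag.memLp_vMeasure hV)
  have hp : ∫ x, h x * f x ∂(vMeasure V hV) =
      ∫ x, h x * wPrimitive W hW g x ∂(vMeasure V hV) := by
    have h1 : (fun x => h x * wPrimitive W hW g x) =ᵐ[vMeasure V hV]
        fun x => h x * f x - h x * f 0 := by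
      filter_upwards [ae_vMeasure_mem hV] with x hx
      rw [hf.wPrimitive_eq hW ⟨hx.1, hx.2.le⟩, mul_sub]
    rw [integral_congr_ae h1, integral_sub hhf
      ((hf.cadlag_deriv.integrable_vMeasure hV).mul_const _), integral_mul_const,
      hf.integral_eq_zero hW hV, zero_mul, sub_zero]
  have hw := DirichletSpace.isWDeriv_ofDeriv g (hf.memL2Zero hW)
  have hn : ‖hf.toDirichlet hW‖ ^ 2 = ∫ s, g s * g s ∂(wMeasure W hW) := by
    rw [← real_inner_self_eq_norm_sq]
    exact DirichletSpace.inner_eq_integral hw hw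
  rw [hn, (hf.memL2Zero hW).integral_mul_eq_neg (hV := hV) hf.caglad_deriv hf.cadlag_deriv
    hf.right_deriv, ← hp, ← sub_eq_add_neg, ← integral_sub hff hhf, energy]
  simp_rw [sub_mul]

end IsStrong

end Torus

/-! ### Density of the strong domain -/

section Density

variable {W V : ℝ → ℝ}

/-- The equation `D_V⁺ D_W⁻ f = h` on the torus is solvable for every càdlàg `h` of mean zero. -/
theorem exists_isStrong (hW : IsCadlagIntegrator W) (hV : IsCagladIntegrator V) {h : ℝ → ℝ}
    (hh : IsCadlag h) (hp : Function.Periodic h 1) (h0 : ∫ y, h y ∂(vMeasure V hV) = 0) :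
    ∃ f g, IsStrong W V f g h ∧ f 0 = 0 := by
  obtain ⟨q, hq, hqd⟩ := exists_hasRightDeriv hV.strictMono hV.caglad hh
  have hq1 : q 1 - q 0 = 0 := by
    rw [sub_eq_setIntegral_Iio (hV := hV) hq hh hqd (right_mem_Icc.2 zero_le_one),
      setIntegral_Iio_one_vMeasure, h0]
  have hqp : Function.Periodic q 1 :=
    periodic_of_hasRightDeriv hV.strictMono hV.caglad hV.periodic hq hqd hp (a := 0)
      (by rw [zero_add]; linarith)
  -- The constant of integration is chosen so that `q - m` has mean zero with respect to `dW`.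
  set m : ℝ := (∫ s, q s ∂(wMeasure W hW)) / W 1
  have hg : IsCaglad (q - fun _ => m) := hq.sub (isCaglad_const m)
  have hgd : ∀ x, HasRightDeriv V (q - fun _ => m) x (h x) := fun x => by
    simpa using (hqd x).sub (hasRightDeriv_const V m x)
  have hgp : Function.Periodic (q - fun _ => m) 1 := fun x => by simp [hqp x]
  have hqi : Integrable q (wMeasure W hW) := (hq.memLp_wMeasure hW).integrable (by norm_num)
  obtain ⟨f, hf0, hf, hfd, hfi⟩ := exists_hasLeftDeriv hW.strictMono hW.cadlag hg
  have hf1 : f 1 = 0 := by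
    have h1 := hfi 0 1 zero_le_one
    have h2 : (wMeasure W hW).real univ = W 1 := by
      rw [← wMeasure_real_Ioc hW (right_mem_Icc.2 zero_le_one), Measure.real, Measure.real,
        wMeasure, Measure.restrict_apply_univ, Measure.restrict_apply_self]
    have h3 : ∫ s, (q s - m) ∂(wMeasure W hW) = 0 := by
      rw [integral_sub hqi (integrable_const m), integral_const, h2, smul_eq_mul,
        mul_div_cancel₀ _ hW.map_one_pos.ne', sub_self]
    rw [hf0, sub_zero] at h1
    exact h1.trans h3
  have hfp : Function.Periodic f 1 :=
    periodic_of_hasLeftDeriv hW.strictMono hW.cadlag hW.periodic hf hfd hgp (a := 0)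
      (by rw [zero_add, hf0, hf1])
  exact ⟨f, _, ⟨hfp, hf, hfd, hg, hgd, hh⟩, hf0⟩

/-- An element of `H_{W,𝒟}([0,1])` orthogonal to the strong domain vanishes: by integration by
parts it is orthogonal in `L²(dV)` to every càdlàg function of mean zero, in particular to itself
minus its mean. -/
theorem DirichletSpace.eq_zero_of_forall_inner_eq_zero {hW : IsCadlagIntegrator W}
    (hV : IsCagladIntegrator V) (φ : DirichletSpace W hW)
    (h : ∀ f g h (hf : IsStrong W V f g h), f 0 = 0 → inner ℝ φ (hf.toDirichlet hW) = 0) :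
    φ = 0 := by
  set p := wPrimitive W hW φ.deriv
  have hp : IsCadlag p := isCadlag_wPrimitive φ.isWDeriv_deriv.1.integrable
  have hpi := hp.integrable_vMeasure hV
  set M := (vMeasure V hV).real univ
  have hM : 0 < M := by
    have h1 : V 0 < V 1 := hV.strictMono zero_lt_one
    simp only [M, Measure.real, vMeasure, Measure.restrict_apply_univ,
      lsMeasure_Ico hV.strictMono hV.caglad]
    rw [ENNReal.toReal_ofReal] <;> linarith
  -- `k` is the periodic extension of `p` minus its mean.
  set m : ℝ := (∫ s, p s ∂(vMeasure V hV)) / M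
  set k : ℝ → ℝ := (fun x => p (Int.fract x)) - fun _ => m
  have hk : IsCadlag k := hp.comp_fract.sub (isCadlag_const m)
  have hkp : Function.Periodic k 1 := fun x => by simp [k]
  have hkae : k =ᵐ[vMeasure V hV] fun x => p x - m := by
    filter_upwards [ae_vMeasure_mem hV] with x hx
    simp [k, Int.fract_eq_self.2 hx]
  have hk0 : ∫ y, k y ∂(vMeasure V hV) = 0 := by
    rw [integral_congr_ae hkae, integral_sub hpi (integrable_const m), integral_const, smul_eq_mul,
      mul_div_cancel₀ _ hM.ne', sub_self]
  obtain ⟨f, g, hf, hf0⟩ := exists_isStrong hW hV hk hkp hk0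
  have h1 := h f g k hf hf0
  rw [hf.inner_toDirichlet (hV := hV), neg_eq_zero] at h1
  have hki := hk.integrable_vMeasure hV
  have hkk : Integrable (fun x => k x * k x) (vMeasure V hV) :=
    (hk.memLp_vMeasure hV).integrable_mul (hk.memLp_vMeasure hV)
  have hkpi : Integrable (fun x => k x * p x) (vMeasure V hV) :=
    (hk.memLp_vMeasure hV).integrable_mul (hp.memLp_vMeasure hV)
  have h2 : ∫ x, k x * k x ∂(vMeasure V hV) = 0 := by
    have : (fun x => k x * k x) =ᵐ[vMeasure V hV] fun x => k x * p x - k x * m := by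
      filter_upwards [hkae] with x hx
      rw [← mul_sub, ← hx]
    rw [integral_congr_ae this, integral_sub hkpi (hki.mul_const m), integral_mul_const, hk0, h1,
      zero_mul, sub_zero]
  have h3 : k =ᵐ[vMeasure V hV] fun _ => 0 := by
    have := (integral_eq_zero_iff_of_nonneg (fun x => mul_self_nonneg (k x)) hkk).1 h2
    exact this.mono fun x hx => mul_self_eq_zero.1 hx
  have h4 : ∀ x ∈ Ico (0 : ℝ) 1, p x = m := fun x hx => by
    have := hk.eqOn_of_ae_eq (isCadlag_const 0) h3 hx
    simp only [k, Pi.sub_apply, Int.fract_eq_self.2 hx] at this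
    linarith
  have h5 : m = 0 := by
    rw [← h4 0 ⟨le_rfl, zero_lt_one⟩]
    exact wPrimitive_of_nonpos hW _ le_rfl
  refine DirichletSpace.ext fun t => ?_
  refine (φ.isWDeriv_deriv.2 t).trans (Eq.trans ?_ (rfl : (0 : ℝ) = _))
  rcases t.2.2.eq_or_lt with ht | ht
  · rw [ht]
    exact φ.isWDeriv_deriv.1.wPrimitive_of_one_le le_rfl
  · exact (h4 t ⟨t.2.1, ht⟩).trans h5

/-- The strong functions that vanish at `0`, as a subspace of `H_{W,𝒟}([0,1])`. -/
def strongSubmodule (hW : IsCadlagIntegrator W) (V : ℝ → ℝ) :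
    Submodule ℝ (DirichletSpace W hW) where
  carrier := {φ | ∃ f g h, ∃ hf : IsStrong W V f g h, f 0 = 0 ∧ hf.toDirichlet hW = φ}
  zero_mem' := by
    refine ⟨fun _ => 0, fun _ => 0, fun _ => 0, ⟨fun _ => rfl, isCadlag_const 0,
      hasLeftDeriv_const W 0, isCaglad_const 0, hasRightDeriv_const V 0, isCadlag_const 0⟩, rfl, ?_⟩
    ext t
    rw [IsStrong.toFun_toDirichlet, sub_self]
    rfl
  add_mem' := by
    rintro _ _ ⟨f, g, h, hf, hf0, rfl⟩ ⟨f', g', h', hf', hf0', rfl⟩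
    refine ⟨_, _, _, hf.sub (hf'.const_smul (-1)), by simp [hf0, hf0'], ?_⟩
    rw [hf.toDirichlet_sub hW (hf'.const_smul (-1)), hf'.toDirichlet_const_smul, neg_one_smul,
      sub_neg_eq_add]
  smul_mem' := by
    rintro c _ ⟨f, g, h, hf, hf0, rfl⟩
    exact ⟨_, _, _, hf.const_smul c, by simp [hf0], hf.toDirichlet_const_smul hW c⟩

theorem strongSubmodule_topologicalClosure (hW : IsCadlagIntegrator W)
    (hV : IsCagladIntegrator V) : (strongSubmodule hW V).topologicalClosure = ⊤ := by
  rw [Submodule.topologicalClosure_eq_top_iff]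
  refine (Submodule.eq_bot_iff _).2 fun φ hφ => φ.eq_zero_of_forall_inner_eq_zero hV ?_
  exact fun f g h hf hf0 => (Submodule.mem_orthogonal' _ _).1 hφ _ ⟨f, g, h, hf, hf0, rfl⟩

end Density

/-! ### The embedding into the Sobolev space of the torus -/

section Embedding

variable {W V : ℝ → ℝ}

namespace DirichletSpace

theorem memLp_iccExtend {hW : IsCadlagIntegrator W} (hV : IsCagladIntegrator V)
    (f : DirichletSpace W hW) : MemLp (IccExtend zero_le_one f.toFun) 2 (vMeasure V hV) := by
  rw [f.isWDeriv_deriv.iccExtend_eq]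
  exact (isCadlag_wPrimitive f.isWDeriv_deriv.1.integrable).memLp_vMeasure hV

/-- The map that sends an element of `H_{W,𝒟}([0,1])` to the class in `L²(dV)` of its restriction
to `[0, 1)`. -/
def embed (hW : IsCadlagIntegrator W) (hV : IsCagladIntegrator V) :
    DirichletSpace W hW →L[ℝ] Lp ℝ 2 (vMeasure V hV) :=
  LinearMap.mkContinuous
    { toFun := fun f => (f.memLp_iccExtend hV).toLp _
      map_add' := fun f g =>
        (MemLp.toLp_add (f.memLp_iccExtend hV) (g.memLp_iccExtend hV)).symm ▸ rfl
      map_smul' := fun c f => (MemLp.toLp_const_smul c (f.memLp_iccExtend hV)).symm ▸ rfl }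
    (measureUnivNNReal (vMeasure V hV) ^ (ENNReal.toReal 2)⁻¹ * √(W 1)) fun f => by
      have h := Lp.norm_le_of_ae_bound (f := (f.memLp_iccExtend hV).toLp _) (C := ‖f‖ * √(W 1))
        (by positivity) ((f.memLp_iccExtend hV).coeFn_toLp.mono fun x hx => by
          rw [hx, Real.norm_eq_abs]
          exact f.abs_toFun_le _)
      refine h.trans (le_of_eq ?_)
      ring

theorem embed_ae_eq (hV : IsCagladIntegrator V) {hW : IsCadlagIntegrator W}
    (f : DirichletSpace W hW) :
    embed hW hV f =ᵐ[vMeasure V hV] IccExtend zero_le_one f.toFun :=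
  MemLp.coeFn_toLp (f.memLp_iccExtend hV)

theorem embed_ae_eq_wPrimitive (hV : IsCagladIntegrator V) {hW : IsCadlagIntegrator W}
    {f : DirichletSpace W hW} {F : ℝ → ℝ} (hF : IsWDeriv W hW f.toFun F) :
    embed hW hV f =ᵐ[vMeasure V hV] wPrimitive W hW F := by
  rw [← hF.iccExtend_eq]
  exact embed_ae_eq hV f

/-- A class on the torus with derivative `F` that is represented by a càdlàg function vanishing at
`0` is the primitive of `F`: there is no constant of integration. -/
theorem isWDeriv_of_isTorusDeriv {hW : IsCadlagIntegrator W} {hV : IsCagladIntegrator V}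
    {f : DirichletSpace W hW} {F : ℝ → ℝ} (hF : IsTorusDeriv W V hW hV (embed hW hV f) F) :
    IsWDeriv W hW f.toFun F := by
  obtain ⟨hF0, c, hc⟩ := hF
  set p := wPrimitive W hW f.deriv
  have hp : IsCadlag p := isCadlag_wPrimitive f.isWDeriv_deriv.1.integrable
  have hq : IsCadlag (wPrimitive W hW F - fun _ => -c) :=
    (isCadlag_wPrimitive hF0.integrable).sub (isCadlag_const _)
  have hpq : EqOn p (wPrimitive W hW F - fun _ => -c) (Ico 0 1) := by
    refine hp.eqOn_of_ae_eq (hV := hV) hq ?_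
    filter_upwards [embed_ae_eq_wPrimitive hV f.isWDeriv_deriv, hc] with x h1 h2
    rw [show p x = _ from h1.symm, h2, Pi.sub_apply]
    ring
  have hc0 : c = 0 := by
    have := hpq (left_mem_Ico.2 zero_lt_one)
    simpa [p, wPrimitive_of_nonpos hW _ le_rfl] using this.symm
  refine ⟨hF0, fun t => (f.isWDeriv_deriv.2 t).trans ?_⟩
  rcases t.2.2.eq_or_lt with ht | ht
  · rw [ht, f.isWDeriv_deriv.1.wPrimitive_of_one_le le_rfl, hF0.wPrimitive_of_one_le le_rfl]
  · simpa [hc0] using hpq ⟨t.2.1, ht⟩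

theorem isTorusDeriv_embed {hW : IsCadlagIntegrator W} (hV : IsCagladIntegrator V)
    (f : DirichletSpace W hW) : IsTorusDeriv W V hW hV (embed hW hV f) f.deriv :=
  ⟨f.isWDeriv_deriv.1, 0, (embed_ae_eq_wPrimitive hV f.isWDeriv_deriv).mono fun x hx => by
    rw [hx, zero_add]⟩

theorem embed_injective (hW : IsCadlagIntegrator W) (hV : IsCagladIntegrator V) :
    Function.Injective (embed hW hV) := by
  intro f g hfg
  have hg := isTorusDeriv_embed hV g
  rw [← hfg] at hg
  have h := isWDeriv_of_isTorusDeriv hg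
  exact ext fun t => (h.2 t).trans (g.isWDeriv_deriv.2 t).symm

end DirichletSpace

theorem IsStrong.embed_toDirichlet_ae_eq {hW : IsCadlagIntegrator W} (hV : IsCagladIntegrator V)
    {f g h : ℝ → ℝ} (hf : IsStrong W V f g h) :
    DirichletSpace.embed hW hV (hf.toDirichlet hW) =ᵐ[vMeasure V hV] fun x => f x - f 0 := by
  filter_upwards [DirichletSpace.embed_ae_eq_wPrimitive hV
    (DirichletSpace.isWDeriv_ofDeriv g (hf.memL2Zero hW)), ae_vMeasure_mem hV] with x h1 h2
  rw [← hf.wPrimitive_eq hW ⟨h2.1, h2.2.le⟩, ← h1]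
  rfl

/-- Strong functions that vanish at `0` and approximate an element of `H_{W,𝒟}([0,1])` also
approximate it in `L²(dV)`, since evaluations are bounded, and so in the energetic norm. -/
theorem DirichletSpace.memSobolevDirichlet_embed (hW : IsCadlagIntegrator W)
    (hV : IsCagladIntegrator V) (φ : DirichletSpace W hW) :
    MemSobolevDirichlet W V hV (embed hW hV φ) := by
  have hp : IsCadlag (wPrimitive W hW φ.deriv) :=
    isCadlag_wPrimitive φ.isWDeriv_deriv.1.integrable
  refine ⟨?_, fun x => wPrimitive W hW φ.deriv (Int.fract x), fun x => by simp, hp.comp_fract, ?_,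
    by simp [wPrimitive_of_nonpos hW _ le_rfl]⟩
  swap
  · filter_upwards [embed_ae_eq_wPrimitive hV φ.isWDeriv_deriv, ae_vMeasure_mem hV] with x h1 h2
    rw [h1, Int.fract_eq_self.2 h2]
  have hmem : φ ∈ (strongSubmodule hW V).topologicalClosure := by
    rw [strongSubmodule_topologicalClosure hW hV]
    trivial
  obtain ⟨ψ, hψS, hψ⟩ := mem_closure_iff_seq_limit.1 hmem
  choose f g h hf hf0 hfψ using hψS
  have hae : ∀ n, embed hW hV (ψ n) =ᵐ[vMeasure V hV] f n := fun n => by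
    rw [← hfψ]
    exact ((hf n).embed_toDirichlet_ae_eq hV).trans (ae_of_all _ fun x => by simp [hf0])
  have hE : Tendsto (fun n => embed hW hV (ψ n)) atTop (𝓝 (embed hW hV φ)) :=
    ((embed hW hV).continuous.tendsto φ).comp hψ
  refine ⟨f, g, h, hf, ?_, fun ε hε => ?_⟩
  · refine ((Lp.tendsto_Lp_iff_tendsto_eLpNorm' _ _).1 hE).congr fun n => ?_
    refine eLpNorm_congr_ae ?_
    filter_upwards [hae n] with x hx
    simp [hx]
  · have hen : ∀ m n, energy V hV (f m - f n) (h m - h n) =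
        ‖embed hW hV (ψ m) - embed hW hV (ψ n)‖ ^ 2 + ‖ψ m - ψ n‖ ^ 2 := by
      intro m n
      rw [((hf m).sub (hf n)).energy_eq hW hV, (hf m).toDirichlet_sub hW (hf n), hfψ, hfψ,
        ← real_inner_self_eq_norm_sq (embed hW hV (ψ m) - embed hW hV (ψ n)), L2.inner_def]
      congr 1
      refine integral_congr_ae ?_
      filter_upwards [Lp.coeFn_sub (embed hW hV (ψ m)) (embed hW hV (ψ n)), hae m, hae n]
        with x h1 h2 h3
      rw [h1]
      simp [h2, h3, sq]
    have hδ : 0 < √(ε / 2) := by positivity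
    obtain ⟨N, hN⟩ := Metric.cauchySeq_iff.1 hψ.cauchySeq _ hδ
    obtain ⟨N', hN'⟩ := Metric.cauchySeq_iff.1 hE.cauchySeq _ hδ
    refine ⟨max N N', fun m hm n hn => ?_⟩
    have h1 := hN m (le_of_max_le_left hm) n (le_of_max_le_left hn)
    have h2 := hN' m (le_of_max_le_right hm) n (le_of_max_le_right hn)
    rw [dist_eq_norm, Real.lt_sqrt (norm_nonneg _)] at h1 h2
    rw [hen]
    linarith

/-- The energetic norm dominates the norm of `H_{W,𝒟}([0,1])`, so that the functions
`f n - f n 0` converge in the latter; the constants `f n 0` then converge as well. -/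
theorem MemSobolev.exists_eq_embed_add (hW : IsCadlagIntegrator W) {hV : IsCagladIntegrator V}
    {u : Lp ℝ 2 (vMeasure V hV)} (hu : MemSobolev W V hV u) :
    ∃ (φ : DirichletSpace W hW) (c : ℝ),
      u = DirichletSpace.embed hW hV φ + c • (memLp_const (1 : ℝ)).toLp (fun _ => (1 : ℝ)) := by
  obtain ⟨f, g, h, hf, hlim, hcau⟩ := hu
  set ψ : ℕ → DirichletSpace W hW := fun n => (hf n).toDirichlet hW
  have hψ : CauchySeq ψ := by
    refine Metric.cauchySeq_iff.2 fun ε hε => ?_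
    obtain ⟨N, hN⟩ := hcau (ε ^ 2) (by positivity)
    refine ⟨N, fun m hm n hn => ?_⟩
    have h1 := hN m hm n hn
    rw [((hf m).sub (hf n)).energy_eq hW hV, (hf m).toDirichlet_sub hW (hf n)] at h1
    have h2 : 0 ≤ ∫ x, (f m - f n) x * (f m - f n) x ∂(vMeasure V hV) :=
      integral_nonneg fun x => mul_self_nonneg _
    rw [dist_eq_norm]
    exact lt_of_pow_lt_pow_left₀ 2 hε.le (by linarith)
  obtain ⟨φ, hφ⟩ := cauchySeq_tendsto_of_complete hψ
  set e : Lp ℝ 2 (vMeasure V hV) := (memLp_const (1 : ℝ)).toLp (fun _ => (1 : ℝ))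
  have hfu : Tendsto (fun n => DirichletSpace.embed hW hV (ψ n) + f n 0 • e) atTop (𝓝 u) := by
    refine (Lp.tendsto_Lp_iff_tendsto_eLpNorm' _ _).2 (hlim.congr fun n => ?_)
    refine eLpNorm_congr_ae ?_
    filter_upwards [Lp.coeFn_add (DirichletSpace.embed hW hV (ψ n)) (f n 0 • e),
      Lp.coeFn_smul (f n 0) e, (hf n).embed_toDirichlet_ae_eq (hW := hW) hV,
      (memLp_const (1 : ℝ) (p := 2) (μ := vMeasure V hV)).coeFn_toLp] with x h1 h2 h3 h4
    simp only [Pi.sub_apply]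
    rw [h1, Pi.add_apply, h2, h3, Pi.smul_apply, h4]
    simp
  have hc : u - DirichletSpace.embed hW hV φ ∈ Submodule.span ℝ {e} := by
    refine (Submodule.closed_of_finiteDimensional (Submodule.span ℝ {e})).mem_of_tendsto
      (hfu.sub (((DirichletSpace.embed hW hV).continuous.tendsto φ).comp hφ))
      (Eventually.of_forall fun n => ?_)
    simp only [Function.comp_apply, add_sub_cancel_left]
    exact Submodule.smul_mem _ _ (Submodule.mem_span_singleton_self e)
  obtain ⟨c, hc⟩ := Submodule.mem_span_singleton.1 hc
  exact ⟨φ, c, by rw [hc, add_sub_cancel]⟩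

theorem range_embed (hW : IsCadlagIntegrator W) (hV : IsCagladIntegrator V) :
    range (DirichletSpace.embed hW hV) = {u | MemSobolevDirichlet W V hV u} := by
  refine Subset.antisymm ?_ ?_
  · rintro _ ⟨φ, rfl⟩
    exact φ.memSobolevDirichlet_embed hW hV
  · rintro u ⟨hu, f, -, hf, huf, hf0⟩
    obtain ⟨φ, c, rfl⟩ := hu.exists_eq_embed_add hW
    have hp : IsCadlag (wPrimitive W hW φ.deriv - fun _ => -c) :=
      (isCadlag_wPrimitive φ.isWDeriv_deriv.1.integrable).sub (isCadlag_const _)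
    have hfp : EqOn f (wPrimitive W hW φ.deriv - fun _ => -c) (Ico 0 1) := by
      refine hf.eqOn_of_ae_eq (hV := hV) hp ?_
      set e : Lp ℝ 2 (vMeasure V hV) := (memLp_const (1 : ℝ)).toLp (fun _ => (1 : ℝ))
      filter_upwards [huf, Lp.coeFn_add (DirichletSpace.embed hW hV φ) (c • e),
        Lp.coeFn_smul c e, DirichletSpace.embed_ae_eq_wPrimitive hV φ.isWDeriv_deriv,
        (memLp_const (1 : ℝ) (p := 2) (μ := vMeasure V hV)).coeFn_toLp] with x h0 h1 h2 h3 h4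
      rw [← h0, h1, Pi.add_apply, h2, h3, Pi.smul_apply, h4]
      simp
    have hc : c = 0 := by
      have := hfp (left_mem_Ico.2 zero_lt_one)
      simpa [hf0, wPrimitive_of_nonpos hW _ le_rfl] using this.symm
    exact ⟨φ, by simp [hc]⟩

end Embedding

end

theorem proposition7p2 (W : ℝ → ℝ) (hW : IsCadlagIntegrator W)
    {Ω : Type*} [MeasurableSpace Ω] (P : Measure Ω) [IsProbabilityMeasure P]
    (X : unitInterval → Ω → ℝ) (hX : IsWBrownianBridge W X P) :
    -- the Cameron–Martin space of `X` is `H_{W,𝒟}([0,1])`, with the same inner product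
    (∃ e : CameronMartinSpace X P hX.memLp ≃ₗᵢ[ℝ] DirichletSpace W hW,
      ∀ f, (e f).toFun = f.toFun) ∧
    -- `H_{W,𝒟}([0,1])` is a reproducing kernel Hilbert space, with the covariance as its kernel
    (∃ (_ : CompleteSpace (DirichletSpace W hW))
      (_ : RKHS ℝ (DirichletSpace W hW) unitInterval ℝ),
      (∀ f : DirichletSpace W hW, ⇑f = f.toFun) ∧
      ∀ s t, RKHS.kernel (DirichletSpace W hW) s t 1 = bridgeKernel W s t) ∧
    -- for every `V`, `H_{W,𝒟}([0,1])` is identified with `H_{W,V,𝒟}(𝕋)`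
    ∀ (V : ℝ → ℝ) (hV : IsCagladIntegrator V),
      ∃ ι : DirichletSpace W hW →ₗ[ℝ] Lp ℝ 2 (vMeasure V hV),
        (∀ f, ι f =ᵐ[vMeasure V hV] Set.IccExtend zero_le_one f.toFun) ∧
        Function.Injective ι ∧
        Set.range ι = {u | MemSobolevDirichlet W V hV u} ∧
        (∀ f, ∃ F, IsTorusDeriv W V hW hV (ι f) F) ∧
        ∀ f g : DirichletSpace W hW, ∀ F G : ℝ → ℝ,
          IsTorusDeriv W V hW hV (ι f) F → IsTorusDeriv W V hW hV (ι g) G →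
          ∫ s, F s * G s ∂(wMeasure W hW) = inner ℝ f g := by
  refine ⟨hX.exists_linearIsometryEquiv hW, ⟨inferInstance, DirichletSpace.rkhs hW,
    DirichletSpace.rkhs_coe, DirichletSpace.rkhs_kernel hW⟩, fun V hV =>
    ⟨DirichletSpace.embed hW hV, DirichletSpace.embed_ae_eq hV,
      DirichletSpace.embed_injective hW hV, range_embed hW hV,
      fun f => ⟨f.deriv, f.isTorusDeriv_embed hV⟩, fun f g F G hF hG => ?_⟩⟩
  exact (DirichletSpace.inner_eq_integral (DirichletSpace.isWDeriv_of_isTorusDeriv hF)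
    (DirichletSpace.isWDeriv_of_isTorusDeriv hG)).symm
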